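/- \textbf{Language and semantics.} Let $\mathcal L$ be the language built from countably many propositional variables with $\wedge,\vee,\Rightarrow,\Leftarrow$ (co-implication), the unary modalities $\mathsf X,\mathsf Y,\mathsf G,\mathsf H$ and the binary modalities $\mathsf U$ (until), $\mathsf S$ (since). A \emph{flow} $(T,\sigma)$ is a set $T$ with a bijection $\sigma\colon T\to T$. A \emph{real valuation} on it is a function $V\colon\mathcal L\times T\to[0,1]$ with $V(\varphi\wedge\psi,t)=\min\{V(\varphi,t),V(\psi,t)\}$, $V(\varphi\vee\psi,t)=\max\{V(\varphi,t),V(\psi,t)\}$; $V(\varphi\Rightarrow\psi,t)=1$ if $V(\varphi,t)\le V(\psi,t)$ and $V(\psi,t)$ otherwise; $V(\varphi\Leftarrow\psi,t)=0$ if $V(\varphi,t)\le V(\psi,t)$ and $V(\varphi,t)$ otherwise; $V(\mathsf X\varphi,t)=V(\varphi,\sigma t)$, $V(\mathsf Y\varphi,t)=V(\varphi,\sigma^{-1}t)$; $V(\mathsf G\varphi,t)=\inf_{n\ge0}V(\varphi,\sigma^nt)$, $V(\mathsf H\varphi,t)=\inf_{n\ge0}V(\varphi,\sigma^{-n}t)$;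 $V(\varphi\,\mathsf U\,\psi,t)=\sup_{n\ge0}\min\{V(\varphi,\sigma^0t),\dots,V(\varphi,\sigma^{n-1}t),V(\psi,\sigma^nt)\}$; and $V(\varphi\,\mathsf S\,\psi,t)$ likewise with $\sigma^{-1}$ in place of $\sigma$. The formula $\varphi$ is \emph{falsifiable over flows} if $V(\varphi,t)\neq1$ for some flow, valuation and $t$. A \emph{bi-relational frame} consists of a linear order $(W,\le)$ and a flow $(T,\sigma)$. A \emph{valuation} on it assigns to every formula a set $[\![\varphi]\!]\subseteq W\times T$ such that $[\![p]\!]$ is downward closed in $W$ for every variable $p$; $\wedge,\vee$ are intersection and union; $(w,t)\in[\![\varphi\Rightarrow\psi]\!]$ iff for all $v\le w$, $(v,t)\in[\![\varphi]\!]$ implies $(v,t)\in[\![\psi]\!]$; $(w,t)\in[\![\varphi\Leftarrow\psi]\!]$ iff some $v\ge w$ has $(v,t)\in[\![\varphi]\!]\setminus[\![\psi]\!]$; and the modalities are interpreted as usual along $\sigma$ with $w$ fixed ($\mathsf G,\mathsf H,\mathsf U,\mathsf S$ reflexively). The formula $\varphi$ is \emph{falsifiable over bi-relational frames} if $[\![\varphi]\!]\ne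 W\times T$ for some frame and valuation. \textbf{Types and moments.} Let $\Sigma\subseteq\mathcal L$ be closed under subformulas. A \emph{$\Sigma$-type} is a set $\Phi\subseteq\Sigma$ such that, for the formulas displayed that lie in $\Sigma$: $\varphi\wedge\psi\in\Phi$ iff $\varphi,\psi\in\Phi$; $\varphi\vee\psi\in\Phi$ iff $\varphi\in\Phi$ or $\psi\in\Phi$; $\varphi\Rightarrow\psi\in\Phi$ implies $\varphi\notin\Phi$ or $\psi\in\Phi$; $\psi\in\Phi$ implies $\varphi\Rightarrow\psi\in\Phi$; $\varphi\Leftarrow\psi\in\Phi$ implies $\varphi\in\Phi$; $\varphi\in\Phi$ and $\psi\notin\Phi$ imply $\varphi\Leftarrow\psi\in\Phi$. A \emph{$\Sigma$-moment} is a finite sequence $\mathfrak m=(\mathfrak m_0,\dots,\mathfrak m_m)$ ($m\ge0$) of $\Sigma$-types with $\mathfrak m_0\supsetneq\mathfrak m_1\supsetneq\dots\supsetneq\mathfrak m_m$ such that for every $\varphi\Rightarrow\psi\in\Sigma\setminus\mathfrak m_i$ there is $j\le i$ with $\varphi\in\mathfrak m_j$, $\psi\notin\mathfrak m_j$, and for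 every $\varphi\Leftarrow\psi\in\mathfrak m_i$ there is $j\ge i$ with $\varphi\in\mathfrak m_j$, $\psi\notin\mathfrak m_j$. Put $|\mathfrak m|=\{\mathfrak m_0,\dots,\mathfrak m_m\}$, linearly ordered by index. \textbf{Relations.} A relation $R\subseteq A\times B$ between posets is \emph{convex} if images and preimages of points are convex, and \emph{fully confluent} if: $x\le x'\,R\,y'$ implies $x\,R\,y\le y'$ for some $y$; $x'\ge x\,R\,y$ implies $x'\,R\,y'\ge y$ for some $y'$; $x'\,R\,y'\ge y$ implies $x'\ge x\,R\,y$ for some $x$; $x\,R\,y\le y'$ implies $x\le x'\,R\,y'$ for some $x'$. A relation between sets of $\Sigma$-types is \emph{sensible} if each of its pairs $(\Phi,\Psi)$ satisfies, for the modal formulas displayed that lie in $\Sigma$: $\mathsf X\varphi\in\Phi$ iff $\varphi\in\Psi$; $\mathsf Y\varphi\in\Psi$ iff $\varphi\in\Phi$; $\mathsf G\varphi\in\Phi$ iff $\varphi\in\Phi$ and $\mathsf G\varphi\in\Psi$; $\mathsf H\varphi\in\Psi$ iff $\varphi\in\Psi$ and $\mathsf H\varphi\in\Phi$; $\varphi\,\mathsf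 U\,\psi\in\Phi$ iff $\psi\in\Phi$ or ($\varphi\in\Phi$ and $\varphi\,\mathsf U\,\psi\in\Psi$); $\varphi\,\mathsf S\,\psi\in\Psi$ iff $\psi\in\Psi$ or ($\varphi\in\Psi$ and $\varphi\,\mathsf S\,\psi\in\Phi$). \textbf{Witnesses.} A \emph{small falsifiability witness} for $\varphi$ (over $\Sigma$) consists of integers $i,i'\ge0$ and $l,l'\ge1$, a finite sequence of $\Sigma$-moments $\mathfrak m^{-i'-l'},\dots,\mathfrak m^{-i'},\dots,\mathfrak m^{0},\dots,\mathfrak m^{i},\dots,\mathfrak m^{i+l}$, and relations $\emptyset\ne S_k\subseteq|\mathfrak m^k|\times|\mathfrak m^{k+1}|$ for $-i'-l'\le k<i+l$, such that: (A) $\varphi\notin\Phi$ for some $\Phi\in|\mathfrak m^0|$; (B) $\mathfrak m^{-i'}=\mathfrak m^{-i'-l'}$ and $\mathfrak m^i=\mathfrak m^{i+l}$; (C) each $S_k$ is fully confluent, convex and sensible; (D) if $\Phi\in|\mathfrak m^i|$ and $\alpha\,\mathsf U\,\beta\in\Phi$, there are $r<l$ and $\Phi=\Phi_0,\dots,\Phi_r$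 with $\Phi_k\,S_{i+k}\,\Phi_{k+1}$ and $\alpha\in\Phi_k$ for $k<r$, and $\beta\in\Phi_r$; (E) if $\Phi\in|\mathfrak m^i|$ and $\mathsf G\beta\in\Sigma\setminus\Phi$, there are $r<l$ and $\Phi=\Phi_0,\dots,\Phi_r$ with $\Phi_k\,S_{i+k}\,\Phi_{k+1}$ for $k<r$, and $\beta\notin\Phi_r$; (F) if $\Phi\in|\mathfrak m^{-i'}|$ and $\alpha\,\mathsf S\,\beta\in\Phi$, there are $r<l'$ and $\Phi=\Phi_0,\dots,\Phi_r$ with $\Phi_{k+1}\,S_{-i'-k-1}\,\Phi_k$ and $\alpha\in\Phi_k$ for $k<r$, and $\beta\in\Phi_r$; (G) if $\Phi\in|\mathfrak m^{-i'}|$ and $\mathsf H\beta\in\Sigma\setminus\Phi$, there are $r<l'$ and $\Phi=\Phi_0,\dots,\Phi_r$ with $\Phi_{k+1}\,S_{-i'-k-1}\,\Phi_k$ for $k<r$, and $\beta\notin\Phi_r$. \textbf{Theorem.} Let $\varphi\in\mathcal L$ and let $\Sigma$ be any finite set of formulas closed under subformulas with $\varphi\in\Sigma$ (for example, the set of subformulas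 of $\varphi$). Then the following are equivalent: (1) $\varphi$ is falsifiable over flows; (2) $\varphi$ is falsifiable over bi-relational frames; (3) $\varphi$ has a small falsifiability witness over $\Sigma$. -/

import Mathlib

namespace GTL

/-! ### Syntax -/

/-- Formulas of the Gödel temporal language, over the propositional variables `ℕ`. -/
inductive Formula : Type where
  | var : ℕ → Formula
  | and : Formula → Formula → Formula
  | or : Formula → Formula → Formula
  /-- implication `φ ⇒ ψ` -/
  | imp : Formula → Formula → Formula
  /-- co-implication `φ ⇐ ψ` -/
  | coimp : Formula → Formula → Formula
  /-- `X φ` (next) -/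
  | X : Formula → Formula
  /-- `Y φ` (yesterday) -/
  | Y : Formula → Formula
  /-- `G φ` (going to always be) -/
  | G : Formula → Formula
  /-- `H φ` (has always been) -/
  | H : Formula → Formula
  /-- `φ U ψ` (until) -/
  | U : Formula → Formula → Formula
  /-- `φ S ψ` (since) -/
  | S : Formula → Formula → Formula

/-- The immediate subformulas of a formula. -/
def Formula.children : Formula → Set Formula
  | .var _ => ∅
  | .and φ ψ => {φ, ψ}
  | .or φ ψ => {φ, ψ}
  | .imp φ ψ => {φ, ψ}
  | .coimp φ ψ => {φ, ψ}
  | .X φ => {φ}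
  | .Y φ => {φ}
  | .G φ => {φ}
  | .H φ => {φ}
  | .U φ ψ => {φ, ψ}
  | .S φ ψ => {φ, ψ}

/-- `Sg` is closed under subformulas. -/
def SubformulaClosed (Sg : Set Formula) : Prop :=
  ∀ φ ∈ Sg, φ.children ⊆ Sg

/-! ### Real-valued semantics -/

/-- A real valuation on the flow `(T, S)`: a set `T` with a bijection `S` of `T`.
Infima and suprema are taken in the complete lattice `[0,1]`; the infimum of the empty family
is `1`. -/
structure RealValuation {T : Type*} (S : Equiv.Perm T) where
  V : Formula → T → unitInterval
  and_eq : ∀ φ ψ t, V (.and φ ψ) t = min (V φ t) (V ψ t)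
  or_eq : ∀ φ ψ t, V (.or φ ψ) t = max (V φ t) (V ψ t)
  imp_eq : ∀ φ ψ t, V (.imp φ ψ) t = if V φ t ≤ V ψ t then 1 else V ψ t
  coimp_eq : ∀ φ ψ t, V (.coimp φ ψ) t = if V φ t ≤ V ψ t then 0 else V φ t
  X_eq : ∀ φ t, V (.X φ) t = V φ (S t)
  Y_eq : ∀ φ t, V (.Y φ) t = V φ (S⁻¹ t)
  G_eq : ∀ φ t, V (.G φ) t = ⨅ n : ℕ, V φ ((S ^ n) t)
  H_eq : ∀ φ t, V (.H φ) t = ⨅ n : ℕ, V φ ((S⁻¹ ^ n) t)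
  U_eq : ∀ φ ψ t, V (.U φ ψ) t =
    ⨆ n : ℕ, min ((Finset.range n).inf fun k => V φ ((S ^ k) t)) (V ψ ((S ^ n) t))
  S_eq : ∀ φ ψ t, V (.S φ ψ) t =
    ⨆ n : ℕ, min ((Finset.range n).inf fun k => V φ ((S⁻¹ ^ k) t)) (V ψ ((S⁻¹ ^ n) t))

/-- `φ` is valid over the class of all flows. -/
def RealValid.{u} (φ : Formula) : Prop :=
  ∀ (T : Type u) (S : Equiv.Perm T) (V : RealValuation S) (t : T), V.V φ t = 1

/-- `φ` is falsifiable over the class of all flows. -/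
def RealFalsifiable.{u} (φ : Formula) : Prop := ¬ RealValid.{u} φ

/-! ### Bi-relational semantics -/

/-- The map `(w, t) ↦ (w, S t)` on `W × T`. -/
def step (W : Type*) {T : Type*} (S : Equiv.Perm T) : W × T → W × T := fun x => (x.1, S x.2)

/-- A bi-relational valuation on the frame `(W, T, ≤, S)`, where `(W, ≤)` is a linear order and
`(T, S)` is a flow. -/
structure RelValuation (W : Type*) [LinearOrder W] {T : Type*} (S : Equiv.Perm T) where
  val : Formula → Set (W × T)
  var_down : ∀ p w v t, v ≤ w → (w, t) ∈ val (.var p) → (v, t) ∈ val (.var p)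
  and_eq : ∀ φ ψ, val (.and φ ψ) = val φ ∩ val ψ
  or_eq : ∀ φ ψ, val (.or φ ψ) = val φ ∪ val ψ
  imp_eq : ∀ φ ψ, val (.imp φ ψ) = {x | ∀ v ≤ x.1, (v, x.2) ∈ val φ → (v, x.2) ∈ val ψ}
  coimp_eq : ∀ φ ψ, val (.coimp φ ψ) = {x | ∃ v ≥ x.1, (v, x.2) ∈ val φ ∧ (v, x.2) ∉ val ψ}
  X_eq : ∀ φ, val (.X φ) = step W S ⁻¹' val φ
  Y_eq : ∀ φ, val (.Y φ) = step W S '' val φ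
  G_eq : ∀ φ, val (.G φ) = ⋂ n : ℕ, (step W S)^[n] ⁻¹' val φ
  H_eq : ∀ φ, val (.H φ) = ⋂ n : ℕ, (step W S)^[n] '' val φ
  U_eq : ∀ φ ψ, val (.U φ ψ) =
    ⋃ n : ℕ, (⋂ k < n, (step W S)^[k] ⁻¹' val φ) ∩ (step W S)^[n] ⁻¹' val ψ
  S_eq : ∀ φ ψ, val (.S φ ψ) =
    ⋃ n : ℕ, (⋂ k < n, (step W S)^[k] '' val φ) ∩ (step W S)^[n] '' val ψ

/-- `φ` is valid over the class of all bi-relational frames. -/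
def RelValid.{u, v} (φ : Formula) : Prop :=
  ∀ (W : Type u) [LinearOrder W] (T : Type v) (S : Equiv.Perm T) (V : RelValuation W S),
    V.val φ = Set.univ

/-- `φ` is falsifiable over the class of all bi-relational frames. -/
def RelFalsifiable.{u, v} (φ : Formula) : Prop := ¬ RelValid.{u, v} φ

/-! ### Types, sensible pairs, confluent and convex relations -/

/-- `Φ` is an `Sg`-type. -/
structure IsType (Sg Φ : Set Formula) : Prop where
  subset : Φ ⊆ Sg
  and_iff : ∀ φ ψ, Formula.and φ ψ ∈ Sg → (Formula.and φ ψ ∈ Φ ↔ φ ∈ Φ ∧ ψ ∈ Φ)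
  or_iff : ∀ φ ψ, Formula.or φ ψ ∈ Sg → (Formula.or φ ψ ∈ Φ ↔ φ ∈ Φ ∨ ψ ∈ Φ)
  imp_elim : ∀ φ ψ, Formula.imp φ ψ ∈ Sg → Formula.imp φ ψ ∈ Φ → φ ∉ Φ ∨ ψ ∈ Φ
  imp_intro : ∀ φ ψ, Formula.imp φ ψ ∈ Sg → ψ ∈ Φ → Formula.imp φ ψ ∈ Φ
  coimp_elim : ∀ φ ψ, Formula.coimp φ ψ ∈ Sg → Formula.coimp φ ψ ∈ Φ → φ ∈ Φ
  coimp_intro : ∀ φ ψ, Formula.coimp φ ψ ∈ Sg → φ ∈ Φ → ψ ∉ Φ → Formula.coimp φ ψ ∈ Φ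

/-- The ordered pair `(Φ, Ψ)` of `Sg`-types is sensible. -/
structure Sensible (Sg Φ Ψ : Set Formula) : Prop where
  X_iff : ∀ φ, Formula.X φ ∈ Sg → (Formula.X φ ∈ Φ ↔ φ ∈ Ψ)
  Y_iff : ∀ φ, Formula.Y φ ∈ Sg → (Formula.Y φ ∈ Ψ ↔ φ ∈ Φ)
  G_iff : ∀ φ, Formula.G φ ∈ Sg → (Formula.G φ ∈ Φ ↔ φ ∈ Φ ∧ Formula.G φ ∈ Ψ)
  H_iff : ∀ φ, Formula.H φ ∈ Sg → (Formula.H φ ∈ Ψ ↔ φ ∈ Ψ ∧ Formula.H φ ∈ Φ)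
  U_iff : ∀ φ ψ, Formula.U φ ψ ∈ Sg →
    (Formula.U φ ψ ∈ Φ ↔ ψ ∈ Φ ∨ (φ ∈ Φ ∧ Formula.U φ ψ ∈ Ψ))
  S_iff : ∀ φ ψ, Formula.S φ ψ ∈ Sg →
    (Formula.S φ ψ ∈ Ψ ↔ ψ ∈ Ψ ∨ (φ ∈ Ψ ∧ Formula.S φ ψ ∈ Φ))

/-- A relation between posets is convex: all images and preimages of points are convex. -/
structure ConvexRel {A B : Type*} [PartialOrder A] [PartialOrder B] (R : A → B → Prop) :
    Prop where
  image : ∀ a, Set.OrdConnected {b | R a b}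
  preimage : ∀ b, Set.OrdConnected {a | R a b}

/-- A relation between posets is fully confluent. -/
structure FullyConfluent {A B : Type*} [PartialOrder A] [PartialOrder B] (R : A → B → Prop) :
    Prop where
  forth_down : ∀ x x' y', x ≤ x' → R x' y' → ∃ y, R x y ∧ y ≤ y'
  forth_up : ∀ x x' y, x ≤ x' → R x y → ∃ y', R x' y' ∧ y ≤ y'
  back_down : ∀ x' y y', R x' y' → y ≤ y' → ∃ x, x ≤ x' ∧ R x y
  back_up : ∀ x y y', R x y → y ≤ y' → ∃ x', x ≤ x' ∧ R x' y'

/-! ### Moments and small falsifiability witnesses -/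

/-- An `Sg`-moment `(𝔪₀, …, 𝔪ₘ)` with `m = top` and `𝔪ᵢ = lab i`. -/
structure Moment (Sg : Set Formula) where
  top : ℕ
  lab : Fin (top + 1) → Set Formula
  isType : ∀ i, IsType Sg (lab i)
  strict : ∀ i j, i < j → lab j ⊂ lab i
  imp_defect : ∀ i φ ψ, Formula.imp φ ψ ∈ Sg \ lab i → ∃ j ≤ i, φ ∈ lab j ∧ ψ ∉ lab j
  coimp_defect : ∀ i φ ψ, Formula.coimp φ ψ ∈ lab i → ∃ j ≥ i, φ ∈ lab j ∧ ψ ∉ lab j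

/-- The set `|𝔪| = {𝔪₀, …, 𝔪ₘ}` of types of a moment. -/
def Moment.carrier {Sg : Set Formula} (m : Moment Sg) : Set (Set Formula) := Set.range m.lab

/-- `R` is a nonempty, fully confluent, convex and sensible relation `R ⊆ |𝔪| × |𝔫|`.
The elements of `|𝔪|` and `|𝔫|` are linearly ordered by their (unique) indices. -/
structure IsTemporalStep {Sg : Set Formula} (m n : Moment Sg)
    (R : Set Formula → Set Formula → Prop) : Prop where
  subset : ∀ Φ Ψ, R Φ Ψ → Φ ∈ m.carrier ∧ Ψ ∈ n.carrier
  nonempty : ∃ Φ Ψ, R Φ Ψ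
  confluent : FullyConfluent fun a b => R (m.lab a) (n.lab b)
  convex : ConvexRel fun a b => R (m.lab a) (n.lab b)
  sensible : ∀ Φ Ψ, R Φ Ψ → Sensible Sg Φ Ψ

/-- A small falsifiability witness for `φ`, made of `Sg`-moments: a finite sequence
`𝔪^{-i'-l'}, …, 𝔪^{-i'}, …, 𝔪^0, …, 𝔪^i, …, 𝔪^{i+l}` of moments (`mom`), with relations
`rel k ⊆ |𝔪^k| × |𝔪^{k+1}|` for `-i'-l' ≤ k < i+l`, where `i, i' ≥ 0` and `l, l' ≥ 1`.
A path of indices `(j_k)_{k ≤ r}` is given as the path `P k` of the corresponding types;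
only the values `P 0, …, P r` matter. -/
structure SmallWitness (Sg : Set Formula) (φ : Formula) where
  i' : ℕ
  i : ℕ
  l' : ℕ
  l : ℕ
  l'_pos : 0 < l'
  l_pos : 0 < l
  mom : Set.Icc (-(i' : ℤ) - l') (i + l) → Moment Sg
  rel : Set.Ico (-(i' : ℤ) - l') (i + l) → Set Formula → Set Formula → Prop
  /-- `φ` is falsified in the moment at position `0`. -/
  falsifies : ∃ Φ ∈ (mom ⟨0, by constructor <;> omega⟩).carrier, φ ∉ Φ
  /-- Repetition at the ends of the past loop and of the future loop. -/
  past_loop : mom ⟨-i', by constructor <;> omega⟩ = mom ⟨-i' - l', by constructor <;> omega⟩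
  future_loop : mom ⟨i, by constructor <;> omega⟩ = mom ⟨i + l, by constructor <;> omega⟩
  step : ∀ (k : ℤ) (h₁ : -(i' : ℤ) - l' ≤ k) (h₂ : k < i + l),
    IsTemporalStep (mom ⟨k, h₁, h₂.le⟩) (mom ⟨k + 1, by constructor <;> omega⟩) (rel ⟨k, h₁, h₂⟩)
  /-- Every until-formula at position `i` is realised within the future loop. -/
  until_realised : ∀ Φ ∈ (mom ⟨i, by constructor <;> omega⟩).carrier, ∀ α β, Formula.U α β ∈ Φ →
    ∃ (r : ℕ) (hr : r < l) (P : ℕ → Set Formula), P 0 = Φ ∧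
      (∀ (k : ℕ) (hk : k < r),
        rel ⟨i + k, by constructor <;> omega⟩ (P k) (P (k + 1)) ∧ α ∈ P k) ∧
      β ∈ P r
  /-- Every `G`-defect at position `i` is realised within the future loop. -/
  G_realised : ∀ Φ ∈ (mom ⟨i, by constructor <;> omega⟩).carrier, ∀ β, Formula.G β ∈ Sg \ Φ →
    ∃ (r : ℕ) (hr : r < l) (P : ℕ → Set Formula), P 0 = Φ ∧
      (∀ (k : ℕ) (hk : k < r), rel ⟨i + k, by constructor <;> omega⟩ (P k) (P (k + 1))) ∧
      β ∉ P r
  /-- Every since-formula at position `-i'` is realised within the past loop. -/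
  since_realised : ∀ Φ ∈ (mom ⟨-i', by constructor <;> omega⟩).carrier, ∀ α β,
    Formula.S α β ∈ Φ →
    ∃ (r : ℕ) (hr : r < l') (P : ℕ → Set Formula), P 0 = Φ ∧
      (∀ (k : ℕ) (hk : k < r),
        rel ⟨-i' - k - 1, by constructor <;> omega⟩ (P (k + 1)) (P k) ∧ α ∈ P k) ∧
      β ∈ P r
  /-- Every `H`-defect at position `-i'` is realised within the past loop. -/
  H_realised : ∀ Φ ∈ (mom ⟨-i', by constructor <;> omega⟩).carrier, ∀ β,
    Formula.H β ∈ Sg \ Φ →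
    ∃ (r : ℕ) (hr : r < l') (P : ℕ → Set Formula), P 0 = Φ ∧
      (∀ (k : ℕ) (hk : k < r), rel ⟨-i' - k - 1, by constructor <;> omega⟩ (P (k + 1)) (P k)) ∧
      β ∉ P r

end GTL

universe u v w

/-!
Both semantics yield the same kind of object: a linear order `W` each of whose points carries a
bi-infinite sequence of types. For a bi-relational model `W` is the given order; for a real model
it is `(0, 1]`, the type at level `x` consisting of the formulas with value at least `x`. Since `Sg`
is finite, only finitely many moments occur along the flow; two far apart positions carrying the
same moment close a loop towards either end that is long enough to realise every eventuality owed
there, which is a small falsifiability witness.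

Conversely, a witness unrolls to a bi-infinite sequence of moments and relations. The points of the
new order are its threads, the bi-infinite paths through the relations. Confluence and convexity
allow two crossing threads to be uncrossed while the eventualities stay realised, so a countable
chain of threads passes through every type and realises every eventuality. This chain is a
bi-relational model over the integers. As it is countable it carries a probability measure charging
all points, and the measures of the truth sets, which are lower sets, form a real model.
-/

namespace GTL

/-! ### Eventualities -/

theorem SubformulaClosed.mem {Sg : Set Formula} (hsub : SubformulaClosed Sg) {φ ψ : Formula}
    (hφ : φ ∈ Sg) (hψ : ψ ∈ φ.children := by simp [Formula.children]) : ψ ∈ Sg :=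
  hsub φ hφ hψ

/-- The direction in which the modality at the head of a formula moves along the flow: `-1` for
`H` and `S`, and `1` for `G` and `U`. The value at other formulas is irrelevant. -/
def Formula.dir : Formula → ℤ
  | .H _ => -1
  | .S _ _ => -1
  | _ => 1

/-- The type `Φ` owes the eventuality `o`: either `o` is an until- or since-formula of `Φ`, or
it is a `G`- or `H`-formula whose failure at `Φ` has to be witnessed. -/
def Pending (Sg : Set Formula) : Formula → Set Formula → Prop
  | .U α β, Φ => .U α β ∈ Φ
  | .S α β, Φ => .S α β ∈ Φ
  | .G β, Φ => .G β ∈ Sg \ Φ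
  | .H β, Φ => .H β ∈ Sg \ Φ
  | _, _ => False

/-- The condition on `Φ` under which the eventuality `o` may be deferred past `Φ`. -/
def Holding : Formula → Set Formula → Prop
  | .U α _, Φ => α ∈ Φ
  | .S α _, Φ => α ∈ Φ
  | _, _ => True

/-- The eventuality `o` is fulfilled at `Φ`. -/
def Fulfilled : Formula → Set Formula → Prop
  | .U _ β, Φ => β ∈ Φ
  | .S _ β, Φ => β ∈ Φ
  | .G β, Φ => β ∉ Φ
  | .H β, Φ => β ∉ Φ
  | _, _ => False

theorem Formula.dir_eq_one_or_neg_one (o : Formula) : o.dir = 1 ∨ o.dir = -1 := by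
  cases o <;> simp [Formula.dir]

theorem Pending.mem {Sg Φ : Set Formula} {o : Formula} (hΦ : Φ ⊆ Sg) (h : Pending Sg o Φ) :
    o ∈ Sg := by
  cases o with
  | U | S => exact hΦ h
  | G | H => exact h.1
  | _ => exact h.elim

theorem Sensible.pending_iff {Sg Φ Ψ : Set Formula} (h : Sensible Sg Φ Ψ) {o : Formula}
    (ho : o ∈ Sg) (hdir : o.dir = 1) :
    Pending Sg o Φ ↔ Fulfilled o Φ ∨ Holding o Φ ∧ Pending Sg o Ψ := by
  cases o with
  | U α β => exact h.U_iff α β ho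
  | G β =>
    have := h.G_iff β ho
    simp only [Pending, Holding, Fulfilled, Set.mem_sdiff, ho, true_and, this]
    tauto
  | H | S => simp [Formula.dir] at hdir
  | _ => simp [Pending, Fulfilled]

theorem Sensible.pending_iff_of_past {Sg Φ Ψ : Set Formula} (h : Sensible Sg Φ Ψ) {o : Formula}
    (ho : o ∈ Sg) (hdir : o.dir = -1) :
    Pending Sg o Ψ ↔ Fulfilled o Ψ ∨ Holding o Ψ ∧ Pending Sg o Φ := by
  cases o with
  | S α β => exact h.S_iff α β ho
  | H β =>
    have := h.H_iff β ho
    simp only [Pending, Holding, Fulfilled, Set.mem_sdiff, ho, true_and, this]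
    tauto
  | _ => simp [Formula.dir] at hdir

/-- A bi-infinite sequence of sets of formulas from `Sg` with sensible successive pairs: the
types met along an orbit of the flow. -/
structure IsTrace (Sg : Set Formula) (τ : ℤ → Set Formula) : Prop where
  subset : ∀ k, τ k ⊆ Sg
  sensible : ∀ k, Sensible Sg (τ k) (τ (k + 1))

/-- Starting at time `k`, the trace `τ` fulfils the eventuality `o` after `r` steps in the direction
of `o`. -/
def RealisesAfter (τ : ℤ → Set Formula) (o : Formula) (k : ℤ) (r : ℕ) : Prop :=
  (∀ j < r, Holding o (τ (k + o.dir * j))) ∧ Fulfilled o (τ (k + o.dir * r))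

/-- Starting at time `k`, the trace `τ` fulfils the eventuality `o` after finitely many steps. -/
def Realises (τ : ℤ → Set Formula) (o : Formula) (k : ℤ) : Prop :=
  ∃ r, RealisesAfter τ o k r

namespace IsTrace

variable {Sg : Set Formula} {τ : ℤ → Set Formula} (h : IsTrace Sg τ)
include h

theorem pending_iff {o : Formula} (ho : o ∈ Sg) (k : ℤ) :
    Pending Sg o (τ k) ↔ Fulfilled o (τ k) ∨ Holding o (τ k) ∧ Pending Sg o (τ (k + o.dir)) := by
  obtain hd | hd := o.dir_eq_one_or_neg_one
  · simpa only [hd] using (h.sensible k).pending_iff ho hd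
  · simpa [hd, ← sub_eq_add_neg] using (h.sensible (k - 1)).pending_iff_of_past ho hd

theorem pending_of_realises {o : Formula} (ho : o ∈ Sg) {k : ℤ} (hk : Realises τ o k) :
    Pending Sg o (τ k) := by
  obtain ⟨r, hold, hful⟩ := hk
  induction r generalizing k with
  | zero => exact (h.pending_iff ho k).2 (.inl (by simpa using hful))
  | succ r ih =>
    have shift (j : ℕ) : k + o.dir * ((j + 1 : ℕ) : ℤ) = k + o.dir + o.dir * j := by
      push_cast; ring
    refine (h.pending_iff ho k).2 (.inr ⟨by simpa using hold 0 r.succ_pos, ih ?_ ?_⟩)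
    · exact fun j hj => shift j ▸ hold (j + 1) (by omega)
    · exact shift r ▸ hful

theorem realises_of_fulfilled {o : Formula} {k : ℤ} (hk : Pending Sg o (τ k)) {r : ℕ}
    (hr : Fulfilled o (τ (k + o.dir * r))) : Realises τ o k := by
  classical
  have ho := hk.mem (h.subset k)
  have hex : ∃ r : ℕ, Fulfilled o (τ (k + o.dir * r)) := ⟨r, hr⟩
  have deferred : ∀ j ≤ Nat.find hex, Pending Sg o (τ (k + o.dir * j)) ∧
      ∀ i < j, Holding o (τ (k + o.dir * i)) := by
    intro j
    induction j with
    | zero => simpa using hk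
    | succ j ih =>
      intro hj
      obtain ⟨hpend, hhold⟩ := ih (by omega)
      obtain ⟨hj', hnext⟩ :=
        ((h.pending_iff ho _).1 hpend).resolve_left (Nat.find_min hex (by omega))
      refine ⟨by convert hnext using 2; push_cast; ring, fun i hi => ?_⟩
      obtain hi | rfl := Nat.lt_succ_iff_lt_or_eq.1 hi
      exacts [hhold i hi, hj']
  exact ⟨Nat.find hex, (deferred _ le_rfl).2, Nat.find_spec hex⟩

end IsTrace

/-! ### Flows of types -/

/-- A linear order `W` in which each point carries a trace of types, antitone in the point and
without defects for the two implications. This is what real and bi-relational models have in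
common. -/
structure TypeFlow (Sg : Set Formula) (W : Type*) [LinearOrder W] where
  ty : ℤ → W → Set Formula
  anti : ∀ k, Antitone (ty k)
  isType : ∀ k w, IsType Sg (ty k w)
  imp_defect : ∀ k w φ ψ, Formula.imp φ ψ ∈ Sg \ ty k w → ∃ v ≤ w, φ ∈ ty k v ∧ ψ ∉ ty k v
  coimp_defect : ∀ k w φ ψ, Formula.coimp φ ψ ∈ ty k w → ∃ v ≥ w, φ ∈ ty k v ∧ ψ ∉ ty k v
  sensible : ∀ k w, Sensible Sg (ty k w) (ty (k + 1) w)

namespace TypeFlow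

variable {Sg : Set Formula} {W : Type*} [LinearOrder W]

theorem isTrace (F : TypeFlow Sg W) (w : W) : IsTrace Sg fun k => F.ty k w :=
  ⟨fun k => (F.isType k w).subset, fun k => F.sensible k w⟩

/-- Each eventuality owed at `(k, w)` is realised along the trace of some point with the same type
at time `k`, possibly different from `w`. -/
def Realising (F : TypeFlow Sg W) : Prop :=
  ∀ o k w, Pending Sg o (F.ty k w) → ∃ v, F.ty k v = F.ty k w ∧ Realises (F.ty · v) o k

/-- Each eventuality owed at `(k, w)` is realised along the trace of `w` itself. -/
def Exact (F : TypeFlow Sg W) : Prop :=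
  ∀ o k w, Pending Sg o (F.ty k w) → Realises (F.ty · w) o k

theorem Exact.realising {F : TypeFlow Sg W} (hF : F.Exact) : F.Realising :=
  fun o k w h => ⟨w, rfl, hF o k w h⟩

end TypeFlow

/-! ### Bi-relational models as flows of types -/

theorem exists_until_iff {p q : ℕ → Prop} : (∃ n, (∀ k < n, p k) ∧ q n) ↔
    q 0 ∨ (p 0 ∧ ∃ n, (∀ k < n, p (k + 1)) ∧ q (n + 1)) := by
  rw [← Nat.or_exists_add_one]
  simp only [Nat.forall_lt_succ_left, not_lt_zero, false_imp_iff, implies_true, true_and,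
    and_assoc, exists_and_left]

theorem perm_pow_succ_apply {T : Type*} (S : Equiv.Perm T) (n : ℕ) (t : T) :
    (S ^ (n + 1)) t = (S ^ n) (S t) := by
  rw [pow_succ, Equiv.Perm.mul_apply]

theorem perm_inv_pow_succ_apply {T : Type*} (S : Equiv.Perm T) (n : ℕ) (t : T) :
    (S⁻¹ ^ (n + 1)) (S t) = (S⁻¹ ^ n) t := by
  rw [perm_pow_succ_apply, Equiv.Perm.inv_def, Equiv.symm_apply_apply]

theorem perm_zpow_add_one_apply {T : Type*} (S : Equiv.Perm T) (k : ℤ) (t : T) :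
    (S ^ (k + 1)) t = S ((S ^ k) t) := by
  rw [add_comm, zpow_add, zpow_one, Equiv.Perm.mul_apply]

theorem perm_pow_zpow_apply {T : Type*} (S : Equiv.Perm T) (k : ℤ) (n : ℕ) (t : T) :
    (S ^ n) ((S ^ k) t) = (S ^ (k + 1 * n)) t := by
  rw [one_mul, add_comm, zpow_add, zpow_natCast, Equiv.Perm.mul_apply]

theorem perm_inv_pow_zpow_apply {T : Type*} (S : Equiv.Perm T) (k : ℤ) (n : ℕ) (t : T) :
    (S⁻¹ ^ n) ((S ^ k) t) = (S ^ (k + -1 * n)) t := by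
  rw [neg_one_mul, add_comm, zpow_add, zpow_neg, zpow_natCast, Equiv.Perm.mul_apply, inv_pow]

theorem step_iterate {W T : Type*} (S : Equiv.Perm T) (n : ℕ) (w : W) (t : T) :
    (step W S)^[n] (w, t) = (w, (S ^ n) t) := by
  induction n generalizing t with
  | zero => rfl
  | succ n ih => rw [Function.iterate_succ_apply, step, ih, perm_pow_succ_apply]

theorem mem_image_step_iterate {W T : Type*} (S : Equiv.Perm T) (n : ℕ) (w : W) (t : T)
    (A : Set (W × T)) : (w, t) ∈ (step W S)^[n] '' A ↔ (w, (S⁻¹ ^ n) t) ∈ A := by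
  have hinv (s : T) : (S ^ n) s = t ↔ (S⁻¹ ^ n) t = s := by
    rw [inv_pow, Equiv.Perm.inv_eq_iff_eq, eq_comm]
  simp only [Set.mem_image, Prod.exists, step_iterate, Prod.mk.injEq, hinv]
  simp only [existsAndEq, and_true]

theorem mem_image_step {W T : Type*} (S : Equiv.Perm T) (w : W) (t : T) (A : Set (W × T)) :
    (w, t) ∈ step W S '' A ↔ (w, S⁻¹ t) ∈ A := by
  simpa using mem_image_step_iterate S 1 w t A

namespace RelValuation

variable {W : Type*} [LinearOrder W] {T : Type*} {S : Equiv.Perm T} (V : RelValuation W S)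

theorem mem_X {φ w t} : (w, t) ∈ V.val (.X φ) ↔ (w, S t) ∈ V.val φ := by
  rw [V.X_eq]; rfl

theorem mem_Y {φ w t} : (w, t) ∈ V.val (.Y φ) ↔ (w, S⁻¹ t) ∈ V.val φ := by
  rw [V.Y_eq, mem_image_step]

theorem mem_G {φ w t} : (w, t) ∈ V.val (.G φ) ↔ ∀ n : ℕ, (w, (S ^ n) t) ∈ V.val φ := by
  simp [V.G_eq, step_iterate]

theorem mem_H {φ w t} : (w, t) ∈ V.val (.H φ) ↔ ∀ n : ℕ, (w, (S⁻¹ ^ n) t) ∈ V.val φ := by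
  simp only [V.H_eq, Set.mem_iInter, mem_image_step_iterate]

theorem mem_U {φ ψ w t} : (w, t) ∈ V.val (.U φ ψ) ↔
    ∃ n : ℕ, (∀ k < n, (w, (S ^ k) t) ∈ V.val φ) ∧ (w, (S ^ n) t) ∈ V.val ψ := by
  simp [V.U_eq, step_iterate]

theorem mem_S {φ ψ w t} : (w, t) ∈ V.val (.S φ ψ) ↔
    ∃ n : ℕ, (∀ k < n, (w, (S⁻¹ ^ k) t) ∈ V.val φ) ∧ (w, (S⁻¹ ^ n) t) ∈ V.val ψ := by
  simp only [V.S_eq, Set.mem_iUnion, Set.mem_inter_iff, Set.mem_iInter, mem_image_step_iterate]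

theorem down {φ : Formula} {v w : W} {t : T} (hvw : v ≤ w) (h : (w, t) ∈ V.val φ) :
    (v, t) ∈ V.val φ := by
  induction φ generalizing t with
  | var p => exact V.var_down p w v t hvw h
  | and φ ψ ihφ ihψ => rw [V.and_eq] at h ⊢; exact ⟨ihφ h.1, ihψ h.2⟩
  | or φ ψ ihφ ihψ => rw [V.or_eq] at h ⊢; exact h.imp ihφ ihψ
  | imp φ ψ => rw [V.imp_eq] at h ⊢; exact fun u hu => h u (hu.trans hvw)
  | coimp φ ψ => rw [V.coimp_eq] at h ⊢; exact h.imp fun u hu => ⟨hvw.trans hu.1, hu.2⟩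
  | X φ ih => rw [V.mem_X] at h ⊢; exact ih h
  | Y φ ih => rw [V.mem_Y] at h ⊢; exact ih h
  | G φ ih => rw [V.mem_G] at h ⊢; exact fun n => ih (h n)
  | H φ ih => rw [V.mem_H] at h ⊢; exact fun n => ih (h n)
  | U φ ψ ihφ ihψ =>
    rw [V.mem_U] at h ⊢
    exact h.imp fun n hn => ⟨fun k hk => ihφ (hn.1 k hk), ihψ hn.2⟩
  | S φ ψ ihφ ihψ =>
    rw [V.mem_S] at h ⊢
    exact h.imp fun n hn => ⟨fun k hk => ihφ (hn.1 k hk), ihψ hn.2⟩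

/-- The set of formulas of `Sg` that are true at `(w, t)`. -/
def typeAt (Sg : Set Formula) (t : T) (w : W) : Set Formula := {ψ ∈ Sg | (w, t) ∈ V.val ψ}

variable {Sg : Set Formula}

theorem mem_typeAt {ψ : Formula} (hψ : ψ ∈ Sg) {t : T} {w : W} :
    ψ ∈ V.typeAt Sg t w ↔ (w, t) ∈ V.val ψ := by
  simp [typeAt, hψ]

theorem sensible_typeAt (hsub : SubformulaClosed Sg) (t : T) (w : W) :
    Sensible Sg (V.typeAt Sg t w) (V.typeAt Sg (S t) w) where
  X_iff φ h := by rw [V.mem_typeAt h, V.mem_typeAt (hsub.mem h), V.mem_X]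
  Y_iff φ h := by
    rw [V.mem_typeAt h, V.mem_typeAt (hsub.mem h), V.mem_Y, Equiv.Perm.inv_def,
      Equiv.symm_apply_apply]
  G_iff φ h := by
    simp only [V.mem_typeAt h, V.mem_typeAt (hsub.mem h : φ ∈ Sg), V.mem_G]
    rw [← Nat.and_forall_add_one]
    simp only [perm_pow_succ_apply, pow_zero, Equiv.Perm.one_apply]
  H_iff φ h := by
    simp only [V.mem_typeAt h, V.mem_typeAt (hsub.mem h : φ ∈ Sg), V.mem_H]
    rw [← Nat.and_forall_add_one]
    simp only [perm_inv_pow_succ_apply, pow_zero, Equiv.Perm.one_apply]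
  U_iff φ ψ h := by
    simp only [V.mem_typeAt h, V.mem_typeAt (hsub.mem h : φ ∈ Sg),
      V.mem_typeAt (hsub.mem h : ψ ∈ Sg), V.mem_U]
    rw [exists_until_iff]
    simp only [perm_pow_succ_apply, pow_zero, Equiv.Perm.one_apply]
  S_iff φ ψ h := by
    simp only [V.mem_typeAt h, V.mem_typeAt (hsub.mem h : φ ∈ Sg),
      V.mem_typeAt (hsub.mem h : ψ ∈ Sg), V.mem_S]
    rw [exists_until_iff]
    simp only [perm_inv_pow_succ_apply, pow_zero, Equiv.Perm.one_apply]

theorem isType_typeAt (hsub : SubformulaClosed Sg) (t : T) (w : W) :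
    IsType Sg (V.typeAt Sg t w) where
  subset := Set.sep_subset _ _
  and_iff φ ψ h := by
    rw [V.mem_typeAt h, V.mem_typeAt (hsub.mem h), V.mem_typeAt (hsub.mem h), V.and_eq]; rfl
  or_iff φ ψ h := by
    rw [V.mem_typeAt h, V.mem_typeAt (hsub.mem h), V.mem_typeAt (hsub.mem h), V.or_eq]; rfl
  imp_elim φ ψ h := by
    rw [V.mem_typeAt h, V.mem_typeAt (hsub.mem h), V.mem_typeAt (hsub.mem h), V.imp_eq]
    exact fun hm => Classical.or_iff_not_imp_left.2 fun hφ => hm w le_rfl (not_not.1 hφ)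
  imp_intro φ ψ h hm := ⟨h, by rw [V.imp_eq]; exact fun v hv _ => V.down hv hm.2⟩
  coimp_elim φ ψ h := by
    rw [V.mem_typeAt h, V.mem_typeAt (hsub.mem h), V.coimp_eq]
    exact fun ⟨v, hv, hvφ, _⟩ => V.down hv hvφ
  coimp_intro φ ψ h := by
    rw [V.mem_typeAt h, V.mem_typeAt (hsub.mem h), V.mem_typeAt (hsub.mem h), V.coimp_eq]
    exact fun hφ hψ => ⟨w, le_rfl, hφ, hψ⟩

/-- The flow of types along the orbit of `t`. -/
def typeFlow (hsub : SubformulaClosed Sg) (t : T) : TypeFlow Sg W where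
  ty k w := V.typeAt Sg ((S ^ k) t) w
  anti _ _ _ h _ hψ := ⟨hψ.1, V.down h hψ.2⟩
  isType _ _ := V.isType_typeAt hsub _ _
  imp_defect k w φ ψ h := by
    have hw := h.2
    rw [V.mem_typeAt h.1, V.imp_eq] at hw
    simpa only [V.mem_typeAt (hsub.mem h.1 : φ ∈ Sg), V.mem_typeAt (hsub.mem h.1 : ψ ∈ Sg),
      Set.mem_ofPred_eq, not_forall, exists_prop] using hw
  coimp_defect k w φ ψ h := by
    have hw := h.2
    rw [V.coimp_eq] at hw
    simpa only [V.mem_typeAt (hsub.mem h.1 : φ ∈ Sg), V.mem_typeAt (hsub.mem h.1 : ψ ∈ Sg),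
      Set.mem_ofPred_eq] using hw
  sensible k w := by
    rw [perm_zpow_add_one_apply]
    exact V.sensible_typeAt hsub _ _

theorem typeFlow_exact (hsub : SubformulaClosed Sg) (t : T) : (V.typeFlow hsub t).Exact := by
  intro o k w h
  have ho := h.mem (Set.sep_subset _ _)
  cases o with
  | U α β =>
    simpa only [Realises, RealisesAfter, Holding, Fulfilled, Formula.dir, typeFlow,
      ← perm_pow_zpow_apply, V.mem_typeAt (hsub.mem ho : α ∈ Sg),
      V.mem_typeAt (hsub.mem ho : β ∈ Sg)]
      using V.mem_U.1 h.2
  | S α β =>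
    simpa only [Realises, RealisesAfter, Holding, Fulfilled, Formula.dir, typeFlow,
      ← perm_inv_pow_zpow_apply, V.mem_typeAt (hsub.mem ho : α ∈ Sg),
      V.mem_typeAt (hsub.mem ho : β ∈ Sg)]
      using V.mem_S.1 h.2
  | G β =>
    simpa only [Realises, RealisesAfter, Holding, Fulfilled, Formula.dir, typeFlow,
      ← perm_pow_zpow_apply, V.mem_typeAt (hsub.mem ho : β ∈ Sg), implies_true, true_and]
      using not_forall.1 fun hall => h.2 ((V.mem_typeAt ho).2 (V.mem_G.2 hall))
  | H β =>
    simpa only [Realises, RealisesAfter, Holding, Fulfilled, Formula.dir, typeFlow,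
      ← perm_inv_pow_zpow_apply, V.mem_typeAt (hsub.mem ho : β ∈ Sg), implies_true, true_and]
      using not_forall.1 fun hall => h.2 ((V.mem_typeAt ho).2 (V.mem_H.2 hall))
  | _ => exact h.elim

end RelValuation

/-! ### Real models as flows of types -/

theorem exists_bot_lt_forall_lt {α : Type*} [LinearOrder α] [OrderBot α] [DenselyOrdered α]
    {s : Set α} (hs : s.Finite) {r : α} (hr : ⊥ < r) :
    ∃ r' < r, ⊥ < r' ∧ ∀ x ∈ s, x < r → x < r' := by
  obtain ⟨m, ⟨-, hmr⟩, hmax⟩ := Set.exists_max_image (insert ⊥ s ∩ Set.Iio r) id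
    ((hs.insert ⊥).inter_of_left _) ⟨⊥, Set.mem_insert _ _, hr⟩
  obtain ⟨r', hmr', hr'r⟩ := exists_between (show m < r from hmr)
  exact ⟨r', hr'r, bot_le.trans_lt hmr',
    fun x hx hxr => (hmax x ⟨Set.mem_insert_of_mem _ hx, hxr⟩).trans_lt hmr'⟩

theorem inf_range_succ {α : Type*} [SemilatticeInf α] [OrderTop α] (f : ℕ → α) (n : ℕ) :
    (Finset.range (n + 1)).inf f = f 0 ⊓ (Finset.range n).inf fun k => f (k + 1) := by
  rw [Finset.range_add_one', Finset.inf_insert, Finset.inf_map]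
  rfl

theorem iSup_until_eq {α : Type*} [Order.Frame α] (f g : ℕ → α) :
    ⨆ n, (Finset.range n).inf f ⊓ g n =
      g 0 ⊔ f 0 ⊓ ⨆ n, ((Finset.range n).inf fun k => f (k + 1)) ⊓ g (n + 1) := by
  rw [← sup_iSup_nat_succ, inf_iSup_eq]
  simp only [inf_range_succ, Finset.range_zero, Finset.inf_empty, inf_assoc, top_inf_eq]

theorem exists_of_lt_iSup_until {α : Type*} [CompleteLinearOrder α] {r : α} {f g : ℕ → α}
    (h : r < ⨆ n, (Finset.range n).inf f ⊓ g n) : ∃ n, (∀ k < n, r ≤ f k) ∧ r ≤ g n := by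
  obtain ⟨n, hn⟩ := lt_iSup_iff.1 h
  exact ⟨n, fun k hk => (lt_inf_iff.1 hn).1.le.trans (Finset.inf_le (Finset.mem_range.2 hk)),
    (lt_inf_iff.1 hn).2.le⟩

namespace RealValuation

variable {T : Type*} {S : Equiv.Perm T} (V : RealValuation S)

theorem G_step (φ : Formula) (t : T) : V.V (.G φ) t = min (V.V φ t) (V.V (.G φ) (S t)) := by
  rw [V.G_eq, V.G_eq, ← inf_iInf_nat_succ]
  simp only [perm_pow_succ_apply, pow_zero, Equiv.Perm.one_apply]

theorem H_step (φ : Formula) (t : T) : V.V (.H φ) (S t) = min (V.V φ (S t)) (V.V (.H φ) t) := by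
  rw [V.H_eq, V.H_eq, ← inf_iInf_nat_succ]
  simp only [perm_inv_pow_succ_apply, pow_zero, Equiv.Perm.one_apply]

theorem U_step (φ ψ : Formula) (t : T) :
    V.V (.U φ ψ) t = max (V.V ψ t) (min (V.V φ t) (V.V (.U φ ψ) (S t))) := by
  rw [V.U_eq, V.U_eq, iSup_until_eq]
  simp only [perm_pow_succ_apply, pow_zero, Equiv.Perm.one_apply]

theorem S_step (φ ψ : Formula) (t : T) :
    V.V (.S φ ψ) (S t) = max (V.V ψ (S t)) (min (V.V φ (S t)) (V.V (.S φ ψ) t)) := by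
  rw [V.S_eq, V.S_eq, iSup_until_eq]
  simp only [perm_inv_pow_succ_apply, pow_zero, Equiv.Perm.one_apply]

/-- The set of formulas of `Sg` that have a value of at least `r` at `t`. The thresholds are
positive because all formulas have a value of at least `0`. -/
def typeAt (Sg : Set Formula) (t : T) (r : Set.Ioi (0 : unitInterval)) : Set Formula :=
  {ψ ∈ Sg | r ≤ V.V ψ t}

variable {Sg : Set Formula}

theorem mem_typeAt {ψ : Formula} (hψ : ψ ∈ Sg) {t : T} {r : Set.Ioi (0 : unitInterval)} :
    ψ ∈ V.typeAt Sg t r ↔ r ≤ V.V ψ t := by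
  simp [typeAt, hψ]

theorem sensible_typeAt (hsub : SubformulaClosed Sg) (t : T) (r : Set.Ioi (0 : unitInterval)) :
    Sensible Sg (V.typeAt Sg t r) (V.typeAt Sg (S t) r) where
  X_iff φ h := by rw [V.mem_typeAt h, V.mem_typeAt (hsub.mem h), V.X_eq]
  Y_iff φ h := by
    rw [V.mem_typeAt h, V.mem_typeAt (hsub.mem h), V.Y_eq, Equiv.Perm.inv_def,
      Equiv.symm_apply_apply]
  G_iff φ h := by
    rw [V.mem_typeAt h, V.mem_typeAt h, V.mem_typeAt (hsub.mem h), V.G_step, le_min_iff]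
  H_iff φ h := by
    rw [V.mem_typeAt h, V.mem_typeAt h, V.mem_typeAt (hsub.mem h), V.H_step, le_min_iff]
  U_iff φ ψ h := by
    rw [V.mem_typeAt h, V.mem_typeAt h, V.mem_typeAt (hsub.mem h), V.mem_typeAt (hsub.mem h),
      V.U_step, le_max_iff, le_min_iff]
  S_iff φ ψ h := by
    rw [V.mem_typeAt h, V.mem_typeAt h, V.mem_typeAt (hsub.mem h), V.mem_typeAt (hsub.mem h),
      V.S_step, le_max_iff, le_min_iff]

theorem isType_typeAt (hsub : SubformulaClosed Sg) (t : T) (r : Set.Ioi (0 : unitInterval)) :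
    IsType Sg (V.typeAt Sg t r) where
  subset := Set.sep_subset _ _
  and_iff φ ψ h := by
    rw [V.mem_typeAt h, V.mem_typeAt (hsub.mem h), V.mem_typeAt (hsub.mem h), V.and_eq, le_min_iff]
  or_iff φ ψ h := by
    rw [V.mem_typeAt h, V.mem_typeAt (hsub.mem h), V.mem_typeAt (hsub.mem h), V.or_eq, le_max_iff]
  imp_elim φ ψ h hm := by
    rw [V.mem_typeAt h, V.imp_eq] at hm
    rw [V.mem_typeAt (hsub.mem h), V.mem_typeAt (hsub.mem h), Classical.or_iff_not_imp_left,
      not_not]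
    split_ifs at hm with hle
    exacts [fun hφ => hφ.trans hle, fun _ => hm]
  imp_intro φ ψ h hm := by
    rw [V.mem_typeAt h, V.imp_eq]
    split_ifs
    exacts [unitInterval.le_one', hm.2]
  coimp_elim φ ψ h hm := by
    rw [V.mem_typeAt h, V.coimp_eq] at hm
    rw [V.mem_typeAt (hsub.mem h)]
    split_ifs at hm
    exacts [absurd hm (not_le.2 r.2), hm]
  coimp_intro φ ψ h hφ hψ := by
    rw [V.mem_typeAt (hsub.mem h)] at hφ hψ
    rw [V.mem_typeAt h, V.coimp_eq, if_neg fun hle => hψ (hφ.trans hle)]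
    exact hφ

/-- The flow of types along the orbit of `t`. -/
def typeFlow (hsub : SubformulaClosed Sg) (t : T) :
    TypeFlow Sg (Set.Ioi (0 : unitInterval)) where
  ty k r := V.typeAt Sg ((S ^ k) t) r
  anti _ _ _ h _ hψ := ⟨hψ.1, le_trans h hψ.2⟩
  isType _ _ := V.isType_typeAt hsub _ _
  imp_defect k r φ ψ h := by
    have himp := h.2
    rw [V.mem_typeAt h.1, V.imp_eq] at himp
    split_ifs at himp with hle
    · exact absurd unitInterval.le_one' himp
    · rw [not_le] at himp hle
      exact ⟨⟨min r (V.V φ ((S ^ k) t)), lt_min r.2 (bot_le.trans_lt hle)⟩,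
        Subtype.coe_le_coe.1 (min_le_left _ _), ⟨hsub.mem h.1, min_le_right _ _⟩,
        fun hψ => (lt_min himp hle).not_ge hψ.2⟩
  coimp_defect k r φ ψ h := by
    have hco := h.2
    rw [V.coimp_eq] at hco
    split_ifs at hco with hle
    · exact absurd hco (not_le.2 r.2)
    · exact ⟨⟨V.V φ ((S ^ k) t), lt_of_lt_of_le r.2 hco⟩, hco, ⟨hsub.mem h.1, le_rfl⟩,
        fun hψ => hle hψ.2⟩
  sensible k w := by
    rw [perm_zpow_add_one_apply]
    exact V.sensible_typeAt hsub _ _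

theorem exists_lt_typeAt_eq (hfin : Sg.Finite) (t : T) (r : Set.Ioi (0 : unitInterval)) :
    ∃ r' < r, V.typeAt Sg t r' = V.typeAt Sg t r := by
  obtain ⟨r', hlt, hpos, hr'⟩ := exists_bot_lt_forall_lt (hfin.image fun ψ => V.V ψ t) r.2
  refine ⟨⟨r', hpos⟩, hlt, Set.Subset.antisymm (fun ψ h => ⟨h.1, ?_⟩)
    fun ψ h => ⟨h.1, hlt.le.trans h.2⟩⟩
  by_contra hψ
  exact (hr' _ ⟨ψ, h.1, rfl⟩ (not_le.1 hψ)).not_ge h.2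

/-- A supremum need not be attained, so an until-formula with value `r` may only be realised
below `r`; by finiteness of `Sg` the type does not change slightly below `r`. -/
theorem typeFlow_realising (hsub : SubformulaClosed Sg) (hfin : Sg.Finite) (t : T) :
    (V.typeFlow hsub t).Realising := by
  intro o k r h
  have ho := h.mem (Set.sep_subset _ _)
  obtain ⟨r', hlt, heq⟩ := V.exists_lt_typeAt_eq hfin ((S ^ k) t) r
  cases o with
  | U α β =>
    refine ⟨r', heq, ?_⟩
    have hr' := lt_of_lt_of_le (Subtype.coe_lt_coe.2 hlt) h.2
    rw [V.U_eq] at hr'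
    simpa only [Realises, RealisesAfter, Holding, Fulfilled, Formula.dir, typeFlow,
      ← perm_pow_zpow_apply, V.mem_typeAt (hsub.mem ho : α ∈ Sg),
      V.mem_typeAt (hsub.mem ho : β ∈ Sg)]
      using exists_of_lt_iSup_until hr'
  | S α β =>
    refine ⟨r', heq, ?_⟩
    have hr' := lt_of_lt_of_le (Subtype.coe_lt_coe.2 hlt) h.2
    rw [V.S_eq] at hr'
    simpa only [Realises, RealisesAfter, Holding, Fulfilled, Formula.dir, typeFlow,
      ← perm_inv_pow_zpow_apply, V.mem_typeAt (hsub.mem ho : α ∈ Sg),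
      V.mem_typeAt (hsub.mem ho : β ∈ Sg)]
      using exists_of_lt_iSup_until hr'
  | G β =>
    refine ⟨r, rfl, ?_⟩
    have hr := not_le.1 fun hle => h.2 ⟨ho, hle⟩
    rw [V.G_eq, iInf_lt_iff] at hr
    simpa only [Realises, RealisesAfter, Holding, Fulfilled, Formula.dir, typeFlow,
      ← perm_pow_zpow_apply, V.mem_typeAt (hsub.mem ho : β ∈ Sg), implies_true, true_and,
      not_le] using hr
  | H β =>
    refine ⟨r, rfl, ?_⟩
    have hr := not_le.1 fun hle => h.2 ⟨ho, hle⟩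
    rw [V.H_eq, iInf_lt_iff] at hr
    simpa only [Realises, RealisesAfter, Holding, Fulfilled, Formula.dir, typeFlow,
      ← perm_inv_pow_zpow_apply, V.mem_typeAt (hsub.mem ho : β ∈ Sg), implies_true, true_and,
      not_le] using hr
  | _ => exact h.elim

end RealValuation

/-! ### From flows of types to small witnesses -/

section Correspondence

variable {W A B : Type*} [LinearOrder W] [PartialOrder A] [PartialOrder B] {f : W → A} {g : W → B}

theorem exists_le_eq_of_monotone_surjective (hf : Monotone f) (hf' : f.Surjective) {a : A} {w : W}
    (h : a ≤ f w) : ∃ v ≤ w, f v = a := by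
  obtain ⟨v, rfl⟩ := hf' a
  obtain hvw | hwv := le_total v w
  exacts [⟨v, hvw, rfl⟩, ⟨w, le_rfl, (hf hwv).antisymm h⟩]

theorem exists_ge_eq_of_monotone_surjective (hf : Monotone f) (hf' : f.Surjective) {a : A} {w : W}
    (h : f w ≤ a) : ∃ v ≥ w, f v = a :=
  exists_le_eq_of_monotone_surjective hf.dual hf' h

theorem ordConnected_image_of_monotone_surjective (hf : Monotone f) (hf' : f.Surjective)
    {s : Set W} (hs : s.OrdConnected) : (f '' s).OrdConnected := by
  refine ⟨?_⟩
  rintro _ ⟨w₁, hw₁, rfl⟩ _ ⟨w₂, hw₂, rfl⟩ a ⟨h₁, h₂⟩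
  obtain ⟨v, hv, rfl⟩ := exists_ge_eq_of_monotone_surjective hf hf' h₁
  obtain hvw | hwv := le_total v w₂
  exacts [⟨v, hs.out hw₁ hw₂ ⟨hv, hvw⟩, rfl⟩, ⟨w₂, hw₂, (hf hwv).antisymm h₂⟩]

theorem fullyConfluent_of_monotone_surjective (hf : Monotone f) (hf' : f.Surjective)
    (hg : Monotone g) (hg' : g.Surjective) :
    FullyConfluent fun a b => ∃ w, f w = a ∧ g w = b where
  forth_down := by
    rintro a _ _ h ⟨w, rfl, rfl⟩
    obtain ⟨v, hv, rfl⟩ := exists_le_eq_of_monotone_surjective hf hf' h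
    exact ⟨g v, ⟨v, rfl, rfl⟩, hg hv⟩
  forth_up := by
    rintro _ a _ h ⟨w, rfl, rfl⟩
    obtain ⟨v, hv, rfl⟩ := exists_ge_eq_of_monotone_surjective hf hf' h
    exact ⟨g v, ⟨v, rfl, rfl⟩, hg hv⟩
  back_down := by
    rintro _ b _ ⟨w, rfl, rfl⟩ h
    obtain ⟨v, hv, rfl⟩ := exists_le_eq_of_monotone_surjective hg hg' h
    exact ⟨f v, hf hv, v, rfl, rfl⟩
  back_up := by
    rintro _ _ b ⟨w, rfl, rfl⟩ h
    obtain ⟨v, hv, rfl⟩ := exists_ge_eq_of_monotone_surjective hg hg' h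
    exact ⟨f v, hf hv, v, rfl, rfl⟩

theorem convexRel_of_monotone_surjective (hf : Monotone f) (hf' : f.Surjective)
    (hg : Monotone g) (hg' : g.Surjective) : ConvexRel fun a b => ∃ w, f w = a ∧ g w = b where
  image _ := ordConnected_image_of_monotone_surjective hg hg'
    (Set.ordConnected_singleton.preimage_mono hf)
  preimage b := by
    simpa only [Set.image, Set.mem_preimage, Set.mem_singleton_iff, and_comm] using
      ordConnected_image_of_monotone_surjective hf hf'
        (Set.ordConnected_singleton (a := b) |>.preimage_mono hg)

end Correspondence

theorem exists_strictAnti_range_eq {α : Type*} [PartialOrder α] {X : Set α} (hfin : X.Finite)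
    (hne : X.Nonempty) (hX : IsChain (· ≤ ·) X) :
    ∃ (n : ℕ) (f : Fin (n + 1) → α), StrictAnti f ∧ Set.range f = X := by
  classical
  let _ : LinearOrder X := { (inferInstance : PartialOrder X) with
    le_total := fun a b => hX.total a.2 b.2
    toDecidableLE := Classical.decRel _ }
  have : Fintype X := hfin.fintype
  have : Nonempty X := hne.to_subtype
  have hcard : Fintype.card Xᵒᵈ = (Fintype.card X - 1) + 1 := by
    rw [Fintype.card_orderDual, Nat.sub_add_cancel Fintype.card_pos]
  let e := Fintype.orderIsoFinOfCardEq Xᵒᵈ hcard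
  refine ⟨_, fun i => (OrderDual.ofDual (e i) : X), fun i j h => e.strictMono h, ?_⟩
  exact ((OrderDual.ofDual.surjective.comp e.surjective).range_comp Subtype.val).trans
    Subtype.range_coe

theorem exists_forall_exists_lt_of_finite {α : Type*} {s : Set α} (hs : s.Finite)
    {P : α → ℕ → Prop} (h : ∀ x ∈ s, ∃ r, P x r) : ∃ N, ∀ x ∈ s, ∃ r < N, P x r := by
  choose! f hf using h
  obtain ⟨N, hN⟩ := (hs.image f).bddAbove
  exact ⟨N + 1, fun x hx => ⟨f x, Nat.lt_succ_of_le (hN ⟨x, hx, rfl⟩), hf x hx⟩⟩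

theorem exists_frequently_eq_of_finite_range {α : Type*} {f : ℕ → α} (hf : (Set.range f).Finite) :
    ∃ i, ∃ᶠ n in Filter.atTop, f n = f i := by
  by_contra! h
  obtain ⟨n, hn⟩ := ((Filter.eventually_all_finite hf (p := fun x n => f n ≠ x)).2
    (Set.forall_mem_range.2 h)).exists
  exact hn _ ⟨n, rfl⟩ rfl

theorem Moment.lab_strictAnti {Sg : Set Formula} (m : Moment Sg) : StrictAnti m.lab :=
  fun i j h => m.strict i j h

theorem Moment.exists_monotone_surjective_lab_eq {Sg : Set Formula} (m : Moment Sg) {W : Type*}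
    [Preorder W] {τ : W → Set Formula} (hτ : Antitone τ) (hm : m.carrier = Set.range τ) :
    ∃ f : W → Fin (m.top + 1), Monotone f ∧ f.Surjective ∧ ∀ w, m.lab (f w) = τ w := by
  have hex (w : W) : ∃ i, m.lab i = τ w := Set.mem_range.1 (hm.symm.subset ⟨w, rfl⟩)
  choose f hf using hex
  refine ⟨f, fun v w h => m.lab_strictAnti.le_iff_ge.1 (by rw [hf, hf]; exact hτ h),
    fun i => ?_, hf⟩
  obtain ⟨w, hw⟩ := hm.subset ⟨i, rfl⟩
  exact ⟨w, m.lab_strictAnti.injective ((hf w).trans hw)⟩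

namespace TypeFlow

variable {Sg : Set Formula} {W : Type*} [LinearOrder W] (F : TypeFlow Sg W)

theorem finite_range_ty (hfin : Sg.Finite) (k : ℤ) : (Set.range (F.ty k)).Finite :=
  hfin.finite_subsets.subset (Set.range_subset_iff.2 fun w => (F.isType k w).subset)

theorem exists_moment [Nonempty W] (hfin : Sg.Finite) (k : ℤ) :
    ∃ m : Moment Sg, m.carrier = Set.range (F.ty k) := by
  have hchain : IsChain (· ≤ ·) (Set.range (F.ty k)) := by
    rintro _ ⟨w, rfl⟩ _ ⟨v, rfl⟩ -
    exact (le_total v w).imp (fun h => F.anti k h) (fun h => F.anti k h)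
  obtain ⟨n, f, hanti, hrange⟩ :=
    exists_strictAnti_range_eq (F.finite_range_ty hfin k) (Set.range_nonempty _) hchain
  have point (i) : ∃ w, F.ty k w = f i := Set.mem_range.1 (hrange.subset ⟨i, rfl⟩)
  have index (w) : ∃ i, f i = F.ty k w := Set.mem_range.1 (hrange.symm.subset ⟨w, rfl⟩)
  have le_of_le {v w : W} {i j} (hi : f i = F.ty k v) (hj : f j = F.ty k w) (h : v ≤ w) : i ≤ j :=
    hanti.le_iff_ge.1 (by rw [hi, hj]; exact F.anti k h)
  refine ⟨⟨n, f, fun i => ?_, fun i j h => hanti h, fun i φ ψ h => ?_, fun i φ ψ h => ?_⟩, hrange⟩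
  · obtain ⟨w, hw⟩ := point i
    exact hw ▸ F.isType k w
  · obtain ⟨w, hw⟩ := point i
    obtain ⟨v, hv, hφψ⟩ := F.imp_defect k w φ ψ (hw ▸ h)
    obtain ⟨j, hj⟩ := index v
    exact ⟨j, le_of_le hj hw.symm hv, hj ▸ hφψ⟩
  · obtain ⟨w, hw⟩ := point i
    obtain ⟨v, hv, hφψ⟩ := F.coimp_defect k w φ ψ (hw ▸ h)
    obtain ⟨j, hj⟩ := index v
    exact ⟨j, le_of_le hw.symm hj hv, hj ▸ hφψ⟩

/-- The relation between the types at `k` and the types at `k + 1` of the same points. -/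
def rel (k : ℤ) (Φ Ψ : Set Formula) : Prop := ∃ w, F.ty k w = Φ ∧ F.ty (k + 1) w = Ψ

theorem isTemporalStep_rel [Nonempty W] {k : ℤ} {m n : Moment Sg}
    (hm : m.carrier = Set.range (F.ty k)) (hn : n.carrier = Set.range (F.ty (k + 1))) :
    IsTemporalStep m n (F.rel k) := by
  obtain ⟨f, hf, hf', hfm⟩ := m.exists_monotone_surjective_lab_eq (F.anti k) hm
  obtain ⟨g, hg, hg', hgn⟩ := n.exists_monotone_surjective_lab_eq (F.anti (k + 1)) hn
  have rel_iff : (fun a b => F.rel k (m.lab a) (n.lab b)) = fun a b => ∃ w, f w = a ∧ g w = b := by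
    simp only [rel, ← hfm, ← hgn, m.lab_strictAnti.injective.eq_iff,
      n.lab_strictAnti.injective.eq_iff]
  refine ⟨?_, ‹Nonempty W›.elim fun w => ⟨_, _, w, rfl, rfl⟩, ?_, ?_, ?_⟩
  · rintro _ _ ⟨w, rfl, rfl⟩
    exact ⟨hm ▸ ⟨w, rfl⟩, hn ▸ ⟨w, rfl⟩⟩
  · exact rel_iff ▸ fullyConfluent_of_monotone_surjective hf hf' hg hg'
  · exact rel_iff ▸ convexRel_of_monotone_surjective hf hf' hg hg'
  · rintro _ _ ⟨w, rfl, rfl⟩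
    exact F.sensible k w

variable {F}

theorem Realising.exists_bound (hF : F.Realising) (hfin : Sg.Finite) (k : ℤ) :
    ∃ N : ℕ, ∀ Φ ∈ Set.range (F.ty k), ∀ o, Pending Sg o Φ →
      ∃ r < N, ∃ v, F.ty k v = Φ ∧ RealisesAfter (F.ty · v) o k r := by
  let owed : Set (Set Formula × Formula) := {x | x.1 ∈ Set.range (F.ty k) ∧ Pending Sg x.2 x.1}
  have mem_of_owed {x} (hx : x ∈ owed) : x.2 ∈ Sg := by
    obtain ⟨⟨w, hw⟩, h⟩ := hx
    exact h.mem (hw ▸ (F.isType k w).subset)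
  have owed_finite : owed.Finite := ((F.finite_range_ty hfin k).prod hfin).subset
    fun x hx => ⟨hx.1, mem_of_owed hx⟩
  obtain ⟨N, hN⟩ := exists_forall_exists_lt_of_finite owed_finite
    (P := fun x r => ∃ v, F.ty k v = x.1 ∧ RealisesAfter (F.ty · v) x.2 k r) (by
      rintro ⟨_, o⟩ ⟨⟨w, rfl⟩, h⟩
      obtain ⟨v, hv, r, hr⟩ := hF o k w h
      exact ⟨r, v, hv, hr⟩)
  exact ⟨N, fun Φ hΦ o ho => hN (Φ, o) ⟨hΦ, ho⟩⟩

/-- In each direction `ε` of time, some set of types occurs infinitely often; its second occurrence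
can be taken so late that the eventualities owed at the first one have been realised before. -/
theorem Realising.exists_loop (hF : F.Realising) (hfin : Sg.Finite) (ε : ℤ) :
    ∃ i l : ℕ, 0 < l ∧ Set.range (F.ty (ε * (i + l))) = Set.range (F.ty (ε * i)) ∧
      ∀ Φ ∈ Set.range (F.ty (ε * i)), ∀ o, Pending Sg o Φ →
        ∃ r < l, ∃ v, F.ty (ε * i) v = Φ ∧ RealisesAfter (F.ty · v) o (ε * i) r := by
  have hrange : (Set.range fun n : ℕ => Set.range (F.ty (ε * n))).Finite := by
    refine hfin.finite_subsets.finite_subsets.subset (Set.range_subset_iff.2 fun n => ?_)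
    exact Set.range_subset_iff.2 fun w => (F.isType _ w).subset
  obtain ⟨i, hi⟩ := exists_frequently_eq_of_finite_range hrange
  obtain ⟨N, hN⟩ := hF.exists_bound hfin (ε * i)
  obtain ⟨n, hn, heq⟩ := Filter.frequently_atTop.1 hi (i + N + 1)
  obtain ⟨l, rfl⟩ := Nat.exists_eq_add_of_le (show i ≤ n by omega)
  refine ⟨i, l, by omega, by exact_mod_cast heq, fun Φ hΦ o ho => ?_⟩
  obtain ⟨r, hr, h⟩ := hN Φ hΦ o ho
  exact ⟨r, by omega, h⟩

variable (F)

theorem rel_ty_add (w : W) (k : ℤ) (j : ℕ) :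
    F.rel (k + j) (F.ty (k + 1 * j) w) (F.ty (k + 1 * (j + 1 : ℕ)) w) :=
  ⟨w, by rw [one_mul], by push_cast; rw [one_mul, add_assoc]⟩

theorem rel_ty_sub (w : W) (k : ℤ) (j : ℕ) :
    F.rel (k - j - 1) (F.ty (k + -1 * (j + 1 : ℕ)) w) (F.ty (k + -1 * j) w) :=
  ⟨w, by congr 1; push_cast; ring, by congr 1; ring⟩

variable {F}

theorem Realising.nonempty_smallWitness (hF : F.Realising) (hfin : Sg.Finite) {φ : Formula}
    {w₀ : W} (hw₀ : φ ∉ F.ty 0 w₀) : Nonempty (SmallWitness Sg φ) := by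
  have : Nonempty W := ⟨w₀⟩
  have : Nonempty (Moment Sg) := ⟨(F.exists_moment hfin 0).choose⟩
  have exists_moment (X) (hX : ∃ k, Set.range (F.ty k) = X) : ∃ m : Moment Sg, m.carrier = X := by
    obtain ⟨k, rfl⟩ := hX
    exact F.exists_moment hfin k
  choose! mom hmom using exists_moment
  replace hmom (k : ℤ) := hmom _ ⟨k, rfl⟩
  obtain ⟨i, l, hl, hloop, hful⟩ := hF.exists_loop hfin 1
  obtain ⟨i', l', hl', hloop', hful'⟩ := hF.exists_loop hfin (-1)
  simp only [one_mul, neg_one_mul, neg_add'] at hloop hful hloop' hful'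
  refine ⟨{
    i' := i', i := i, l' := l', l := l, l'_pos := hl', l_pos := hl
    mom := fun k => mom (Set.range (F.ty k))
    rel := fun k => F.rel k
    falsifies := ⟨F.ty 0 w₀, (hmom 0).symm.subset ⟨w₀, rfl⟩, hw₀⟩
    past_loop := congrArg mom hloop'.symm
    future_loop := congrArg mom hloop.symm
    step := fun k _ _ => F.isTemporalStep_rel (hmom k) (hmom (k + 1))
    until_realised := fun Φ hΦ α β h => ?_
    G_realised := fun Φ hΦ β h => ?_
    since_realised := fun Φ hΦ α β h => ?_
    H_realised := fun Φ hΦ β h => ?_ }⟩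
  · obtain ⟨r, hr, v, hv, hhold, hβ⟩ := hful Φ ((hmom i).subset hΦ) (.U α β) h
    exact ⟨r, hr, fun j => F.ty (i + 1 * j) v, by simpa using hv,
      fun k hk => ⟨F.rel_ty_add v i k, hhold k hk⟩, hβ⟩
  · obtain ⟨r, hr, v, hv, -, hβ⟩ := hful Φ ((hmom i).subset hΦ) (.G β) h
    exact ⟨r, hr, fun j => F.ty (i + 1 * j) v, by simpa using hv,
      fun k _ => F.rel_ty_add v i k, hβ⟩
  · obtain ⟨r, hr, v, hv, hhold, hβ⟩ := hful' Φ ((hmom (-i')).subset hΦ) (.S α β) h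
    exact ⟨r, hr, fun j => F.ty (-i' + -1 * j) v, by simpa using hv,
      fun k hk => ⟨F.rel_ty_sub v (-i') k, hhold k hk⟩, hβ⟩
  · obtain ⟨r, hr, v, hv, -, hβ⟩ := hful' Φ ((hmom (-i')).subset hΦ) (.H β) h
    exact ⟨r, hr, fun j => F.ty (-i' + -1 * j) v, by simpa using hv,
      fun k _ => F.rel_ty_sub v (-i') k, hβ⟩

end TypeFlow

/-! ### Thread systems -/

section Glue

variable {α : Type*}

/-- The sequence that follows `p` up to time `N` and `q` afterwards. -/
def glue (N : ℤ) (p q : ℤ → α) (k : ℤ) : α := if k ≤ N then p k else q k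

theorem glue_of_le {N : ℤ} {p q : ℤ → α} {k : ℤ} (h : k ≤ N) : glue N p q k = p k := if_pos h

theorem glue_of_gt {N : ℤ} {p q : ℤ → α} {k : ℤ} (h : N < k) : glue N p q k = q k :=
  if_neg h.not_ge

theorem glue_of_ge {N : ℤ} {p q : ℤ → α} (hN : p N = q N) {k : ℤ} (h : N ≤ k) :
    glue N p q k = q k := by
  rcases h.eq_or_lt with rfl | h
  exacts [(glue_of_le le_rfl).trans hN, glue_of_gt h]

end Glue

theorem add_natCast_le_of_strictMono {N : ℕ → ℤ} (hN : StrictMono N) (n : ℕ) :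
    N 0 + n ≤ N n := by
  induction n with
  | zero => simp
  | succ n ih =>
    have := hN (Nat.lt_add_one n)
    push_cast
    omega

/-- Chains `D k` in a lattice, one for each time `k`, with serial and coserial relations between
successive ones. The condition `uncross` is what full confluence and convexity of these relations
amount to. -/
structure ThreadSystem (α : Type*) [Lattice α] where
  D : ℤ → Set α
  R : ℤ → α → α → Prop
  chain : ∀ k, IsChain (· ≤ ·) (D k)
  mem_left : ∀ {k x y}, R k x y → x ∈ D k
  mem_right : ∀ {k x y}, R k x y → y ∈ D (k + 1)
  serial : ∀ k, ∀ x ∈ D k, ∃ y, R k x y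
  coserial : ∀ k, ∀ y ∈ D (k + 1), ∃ x, R k x y
  uncross : ∀ {k x x' y y'}, R k x y → R k x' y' → x ≤ x' → y' ≤ y → R k x y' ∧ R k x' y

namespace ThreadSystem

variable {α : Type*} [Lattice α]

/-- The thread system read in the opposite direction. -/
def reverse (A : ThreadSystem α) : ThreadSystem α where
  D k := A.D (-k)
  R k x y := A.R (-k - 1) y x
  chain k := A.chain (-k)
  mem_left h := by simpa using A.mem_right h
  mem_right h := by rw [neg_add']; exact A.mem_left h
  serial k x hx := A.coserial (-k - 1) x (by simpa using hx)
  coserial k y hy := A.serial (-k - 1) y (by rwa [neg_add'] at hy)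
  uncross h₁ h₂ hx hy := A.uncross h₂ h₁ hy hx

/-- A bi-infinite path through a thread system. -/
def IsThread (A : ThreadSystem α) (p : ℤ → α) : Prop := ∀ k, A.R k (p k) (p (k + 1))

variable {A : ThreadSystem α}

namespace IsThread

variable {p q : ℤ → α}

theorem mem (hp : A.IsThread p) (k : ℤ) : p k ∈ A.D k := A.mem_left (hp k)

theorem le_total (hp : A.IsThread p) (hq : A.IsThread q) (k : ℤ) : p k ≤ q k ∨ q k ≤ p k :=
  (A.chain k).total (hp.mem k) (hq.mem k)

theorem reverse (hp : A.IsThread p) : A.reverse.IsThread fun k => p (-k) := by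
  intro k
  have := hp (-k - 1)
  rw [sub_add_cancel] at this
  simpa only [ThreadSystem.reverse, neg_add'] using this

theorem of_reverse (hp : A.reverse.IsThread p) : A.IsThread fun k => p (-k) := by
  intro k
  have := hp (-k - 1)
  simp only [ThreadSystem.reverse, neg_sub, sub_neg_eq_add, sub_add_cancel] at this
  rwa [add_sub_cancel_left, ← neg_add'] at this

theorem inf (hp : A.IsThread p) (hq : A.IsThread q) : A.IsThread (p ⊓ q) := by
  intro k
  simp only [Pi.inf_apply]
  obtain h | h := hp.le_total hq k <;> obtain h' | h' := hp.le_total hq (k + 1)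
  · rw [inf_of_le_left h, inf_of_le_left h']; exact hp k
  · rw [inf_of_le_left h, inf_of_le_right h']; exact (A.uncross (hp k) (hq k) h h').1
  · rw [inf_of_le_right h, inf_of_le_left h']; exact (A.uncross (hq k) (hp k) h h').1
  · rw [inf_of_le_right h, inf_of_le_right h']; exact hq k

theorem sup (hp : A.IsThread p) (hq : A.IsThread q) : A.IsThread (p ⊔ q) := by
  intro k
  simp only [Pi.sup_apply]
  obtain h | h := hp.le_total hq k <;> obtain h' | h' := hp.le_total hq (k + 1)
  · rw [sup_of_le_right h, sup_of_le_right h']; exact hq k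
  · rw [sup_of_le_right h, sup_of_le_left h']; exact (A.uncross (hp k) (hq k) h h').2
  · rw [sup_of_le_left h, sup_of_le_right h']; exact (A.uncross (hq k) (hp k) h h').2
  · rw [sup_of_le_left h, sup_of_le_left h']; exact hp k

theorem glue_of_rel (hp : A.IsThread p) (hq : A.IsThread q) {N : ℤ}
    (hN : A.R N (p N) (q (N + 1))) : A.IsThread (glue N p q) := by
  intro k
  rcases lt_trichotomy k N with h | rfl | h
  · rw [glue_of_le h.le, glue_of_le (by omega)]; exact hp k
  · rwa [glue_of_le le_rfl, glue_of_gt (by omega)]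
  · rw [glue_of_gt h, glue_of_gt (by omega)]; exact hq k

theorem glue (hp : A.IsThread p) (hq : A.IsThread q) {N : ℤ} (hN : p N = q N) :
    A.IsThread (glue N p q) :=
  hp.glue_of_rel hq (hN ▸ hq N)

end IsThread

theorem exists_forward_path {k : ℤ} {x : α} (hx : x ∈ A.D k) :
    ∃ f : ℤ → α, f k = x ∧ ∀ j ≥ k, A.R j (f j) (f (j + 1)) := by
  have : Nonempty α := ⟨x⟩
  choose! s hs using A.serial
  let g : ℕ → α := fun n => Nat.rec x (fun n y => s (k + n) y) n
  have hg (n : ℕ) : g n ∈ A.D (k + n) := by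
    induction n with
    | zero => simpa [g] using hx
    | succ n ih => simpa [add_assoc] using A.mem_right (hs _ _ ih)
  refine ⟨fun j => g (j - k).toNat, by simp [g], fun j hj => ?_⟩
  obtain ⟨n, rfl⟩ := Int.le.dest hj
  have h₁ : (k + n - k).toNat = n := by omega
  have h₂ : (k + n + 1 - k).toNat = n + 1 := by omega
  simp only [h₁, h₂]
  exact hs _ _ (hg n)

theorem exists_thread {k : ℤ} {x : α} (hx : x ∈ A.D k) : ∃ p, A.IsThread p ∧ p k = x := by
  obtain ⟨f, hfk, hf⟩ := exists_forward_path hx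
  obtain ⟨g, hgk, hg⟩ := exists_forward_path (A := A.reverse) (k := -k) (x := x)
    (by simpa [reverse] using hx)
  refine ⟨glue k (fun j => g (-j)) f, fun j => ?_, by rw [glue_of_le le_rfl, hgk]⟩
  rcases lt_or_ge j k with h | h
  · rw [glue_of_le h.le, glue_of_le (by omega)]
    have := hg (-j - 1) (by omega)
    simp only [ThreadSystem.reverse, neg_sub, sub_neg_eq_add, sub_add_cancel] at this
    rwa [add_sub_cancel_left, ← neg_add'] at this
  · rw [glue_of_ge (by rw [hgk, hfk]) h, glue_of_gt (by omega)]
    exact hf j h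

theorem exists_thread_extending {k : ℤ} {x : ℕ → α} (hx : x 0 ∈ A.D k) {r : ℕ}
    (h : ∀ j < r, A.R (k + j) (x j) (x (j + 1))) :
    ∃ p, A.IsThread p ∧ ∀ j ≤ r, p (k + j) = x j := by
  induction r with
  | zero =>
    obtain ⟨p, hp, hpk⟩ := exists_thread hx
    exact ⟨p, hp, by simpa using hpk⟩
  | succ r ih =>
    obtain ⟨p, hp, hpx⟩ := ih fun j hj => h j (by omega)
    have hr := h r (by omega)
    obtain ⟨q, hq, hqx⟩ := exists_thread (A.mem_right hr)
    refine ⟨_, hp.glue_of_rel hq (N := k + r) ?_, fun j hj => ?_⟩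
    · rwa [hpx r le_rfl, hqx]
    · rcases hj.eq_or_lt with rfl | hj
      · rw [glue_of_gt (by omega), Nat.cast_succ, ← add_assoc, hqx]
      · rw [glue_of_le (by omega), hpx j (by omega)]

theorem exists_limit_thread {s : ℕ → ℤ → α} (hs : ∀ n, A.IsThread (s n)) {N : ℕ → ℤ}
    (hN : StrictMono N) (hagree : ∀ n, ∀ k ≤ N n, s (n + 1) k = s n k) :
    ∃ q, A.IsThread q ∧ ∀ n, ∀ k ≤ N n, q k = s n k := by
  have hstable {n m : ℕ} (hnm : n ≤ m) {k : ℤ} (hk : k ≤ N n) : s m k = s n k := by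
    induction m, hnm using Nat.le_induction with
    | base => rfl
    | succ m hm ih => rw [← ih, hagree m k (hk.trans (hN.monotone hm))]
  have hlate (k : ℤ) : k ≤ N (k - N 0).toNat := by
    have := add_natCast_le_of_strictMono hN (k - N 0).toNat
    omega
  have hlim (n : ℕ) (k : ℤ) (hk : k ≤ N n) : s (k - N 0).toNat k = s n k := by
    obtain h | h := Nat.le_total n (k - N 0).toNat
    exacts [hstable h hk, (hstable h (hlate k)).symm]
  refine ⟨fun k => s (k - N 0).toNat k, fun k => ?_, hlim⟩
  have := hlate (k + 1)
  simp only [hlim (k + 1 - N 0).toNat k (by omega)]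
  exact hs _ k

/-! ### Fulfilling threads -/

/-- Eventualities, indexed by `ι`, for a thread system: when pending, an eventuality is either done
at once or remains pending in the next step. -/
structure Eventualities (A : ThreadSystem α) (ι : Type*) where
  pend : ι → α → Prop
  done : ι → α → Prop
  persist : ∀ {o k x y}, A.R k x y → pend o x → done o x ∨ pend o y

namespace Eventualities

variable {ι : Type*} (E : Eventualities A ι)

/-- Every eventuality pending on `p` is done later on `p`. -/
def Fulfils (p : ℤ → α) : Prop := ∀ o k, E.pend o (p k) → ∃ n ≥ k, E.done o (p n)

/-- Every eventuality pending at time `k` can be done on some thread. Different eventualities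
may need different threads. -/
def RealisableAt (k : ℤ) : Prop :=
  ∀ o, ∀ x ∈ A.D k, E.pend o x → ∃ p, A.IsThread p ∧ p k = x ∧ ∃ n ≥ k, E.done o (p n)

variable {E}

theorem realisableAt_of_path {k : ℤ}
    (h : ∀ o, ∀ x ∈ A.D k, E.pend o x → ∃ (r : ℕ) (P : ℕ → α), P 0 = x ∧
      (∀ j < r, A.R (k + j) (P j) (P (j + 1))) ∧ E.done o (P r)) : E.RealisableAt k := by
  intro o x hx hpend
  obtain ⟨r, P, rfl, hR, hdone⟩ := h o x hx hpend
  obtain ⟨p, hp, hpP⟩ := exists_thread_extending hx hR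
  exact ⟨p, hp, by simpa using hpP 0 r.zero_le, k + r, by omega, by rwa [hpP r le_rfl]⟩

theorem done_or_pend {p : ℤ → α} (hp : A.IsThread p) {o : ι} {k N : ℤ} (hkN : k ≤ N)
    (h : E.pend o (p k)) : (∃ n ≥ k, E.done o (p n)) ∨ E.pend o (p N) := by
  induction N, hkN using Int.leInduction with
  | base => exact .inr h
  | succ N hN ih =>
    obtain hdone | ih := ih
    exacts [.inl hdone, (E.persist (hp N) ih).imp_left fun h => ⟨N, hN, h⟩]

theorem RealisableAt.of_le {k K : ℤ} (hkK : k ≤ K) (hK : E.RealisableAt K) :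
    E.RealisableAt k := by
  intro o x hx hpend
  obtain ⟨p, hp, rfl⟩ := exists_thread hx
  obtain hdone | hpend := done_or_pend hp hkK hpend
  · exact ⟨p, hp, rfl, hdone⟩
  · obtain ⟨q, hq, hqK, n, hn, hdone⟩ := hK o _ (hp.mem K) hpend
    exact ⟨_, hp.glue hq hqK.symm, glue_of_le hkK, n, hkK.trans hn,
      by rwa [glue_of_ge hqK.symm hn]⟩

theorem fulfils_of_eq {p q : ℤ → α} (hp : A.IsThread p) (hq : E.Fulfils q) {N : ℤ}
    (h : ∀ k ≥ N, p k = q k) : E.Fulfils p := by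
  intro o k hk
  obtain hdone | hpend := done_or_pend hp (le_max_left k N) hk
  · exact hdone
  · rw [h _ (le_max_right k N)] at hpend
    obtain ⟨n, hn, hdone⟩ := hq o _ hpend
    exact ⟨n, (le_max_left k N).trans hn, by rwa [h n ((le_max_right k N).trans hn)]⟩

theorem exists_fulfilling_of_mixture {m p a : ℤ → α} (hm : A.IsThread m)
    (h : ∀ k, m k = p k ∨ m k = a k) (ha : A.IsThread a) (hpE : E.Fulfils p) (haE : E.Fulfils a)
    (t : ℤ) : ∃ q, A.IsThread q ∧ (∀ k ≤ t, q k = m k) ∧ (∀ k, q k = m k ∨ q k = a k) ∧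
      E.Fulfils q := by
  by_cases hN : ∃ N ≥ t, m N = a N
  · obtain ⟨N, hN, heq⟩ := hN
    refine ⟨_, hm.glue ha heq, fun k hk => glue_of_le (hk.trans hN), fun k => ?_,
      fulfils_of_eq (hm.glue ha heq) haE fun k hk => glue_of_ge heq hk⟩
    exact (le_or_gt k N).imp glue_of_le glue_of_gt
  · push Not at hN
    exact ⟨m, hm, fun _ _ => rfl, fun _ => .inl rfl,
      fulfils_of_eq hm hpE fun k hk => (h k).resolve_right (hN k hk)⟩

theorem RealisableAt.exists_extension {N : ℤ} (hE : E.RealisableAt N) (o : ι) {p : ℤ → α}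
    (hp : A.IsThread p) : ∃ q N', A.IsThread q ∧ N < N' ∧ (∀ k ≤ N, q k = p k) ∧
      (E.pend o (p N) → ∃ n, N ≤ n ∧ n ≤ N' ∧ E.done o (q n)) := by
  by_cases hpend : E.pend o (p N)
  · obtain ⟨q, hq, hqN, n, hn, hdone⟩ := hE o _ (hp.mem N) hpend
    exact ⟨_, n + 1, hp.glue hq hqN.symm, by omega, fun k hk => glue_of_le hk,
      fun _ => ⟨n, hn, by omega, by rwa [glue_of_ge hqN.symm hn]⟩⟩
  · exact ⟨p, N + 1, hp, by omega, fun _ _ => rfl, fun h => absurd h hpend⟩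

theorem exists_seq_forall_exists_ge_eq (ι : Type*) [Countable ι] [Nonempty ι] :
    ∃ e : ℕ → ι, ∀ o m, ∃ n ≥ m, e n = o := by
  obtain ⟨f, hf⟩ := exists_surjective_nat ι
  refine ⟨fun n => f n.unpair.1, fun o m => ?_⟩
  obtain ⟨c, rfl⟩ := hf o
  exact ⟨Nat.pair c m, Nat.right_le_pair c m, by simp⟩

theorem exists_fulfilling_thread [Countable ι] (hE : ∀ k, E.RealisableAt k) {k₀ : ℤ} {x₀ : α}
    (hx₀ : x₀ ∈ A.D k₀) : ∃ p, A.IsThread p ∧ p k₀ = x₀ ∧ E.Fulfils p := by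
  obtain ⟨p₀, hp₀, hpk₀⟩ := exists_thread hx₀
  rcases isEmpty_or_nonempty ι with hι | hι
  · exact ⟨p₀, hp₀, hpk₀, fun o => hι.elim o⟩
  choose ext cut hext hcut hagree hdone using fun (N : ℤ) (o : ι) (p : {p // A.IsThread p}) =>
    (hE N).exists_extension o p.2
  obtain ⟨e, he⟩ := exists_seq_forall_exists_ge_eq ι
  let s : ℕ → {p // A.IsThread p} × ℤ := fun n => Nat.rec (⟨p₀, hp₀⟩, k₀)
    (fun n s => (⟨ext s.2 (e n) s.1, hext _ _ _⟩, cut s.2 (e n) s.1)) n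
  have hN : StrictMono fun n => (s n).2 := strictMono_nat_of_lt_succ fun n => hcut _ _ _
  obtain ⟨q, hq, hqs⟩ := exists_limit_thread (fun n => (s n).1.2) hN fun n => hagree _ _ _
  refine ⟨q, hq, (hqs 0 k₀ le_rfl).trans hpk₀, fun o k hk => ?_⟩
  obtain ⟨n, hn, rfl⟩ := he o (k - k₀).toNat
  have hkn : k ≤ (s n).2 := by
    have : k₀ + n ≤ (s n).2 := add_natCast_le_of_strictMono hN n
    omega
  obtain hdoneq | hpend := done_or_pend hq hkn hk
  · exact hdoneq
  · obtain ⟨m, hm, hm', hdone⟩ := hdone _ _ _ (hqs n _ le_rfl ▸ hpend)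
    exact ⟨m, hkn.trans hm, by rwa [hqs (n + 1) m hm']⟩

end Eventualities

/-! ### Chains of good threads -/

/-- A thread that fulfils all eventualities in both directions. The eventualities that look back
in time are those of the reversed thread system. -/
structure IsGood {ι ι' : Type*} (E : Eventualities A ι) (E' : Eventualities A.reverse ι')
    (p : ℤ → α) : Prop where
  isThread : A.IsThread p
  future : E.Fulfils p
  past : E'.Fulfils fun k => p (-k)

section Good

variable {ι ι' : Type*} {E : Eventualities A ι} {E' : Eventualities A.reverse ι'}

theorem exists_isGood [Countable ι] [Countable ι'] (hE : ∀ k, E.RealisableAt k)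
    (hE' : ∀ k, E'.RealisableAt k) {k : ℤ} {x : α} (hx : x ∈ A.D k) :
    ∃ p, IsGood E E' p ∧ p k = x := by
  obtain ⟨p, hp, hpk, hpE⟩ := Eventualities.exists_fulfilling_thread hE hx
  obtain ⟨q, hq, hqk, hqE'⟩ := Eventualities.exists_fulfilling_thread hE'
    (show x ∈ A.reverse.D (-k) by simpa [reverse] using hx)
  have hmeet : q (-k) = p k := hqk.trans hpk.symm
  have hthread := hq.of_reverse.glue hp hmeet
  refine ⟨_, ⟨hthread, Eventualities.fulfils_of_eq hthread hpE fun j hj => glue_of_ge hmeet hj,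
    Eventualities.fulfils_of_eq hthread.reverse hqE' (N := -k) fun j hj => ?_⟩, ?_⟩
  · rw [glue_of_le (by omega), neg_neg]
  · rw [glue_of_le le_rfl, hqk]

namespace IsGood

theorem of_mixture {m p a : ℤ → α} (hm : A.IsThread m) (h : ∀ k, m k = p k ∨ m k = a k)
    (hp : IsGood E E' p) (ha : IsGood E E' a) (t : ℤ) :
    ∃ q, IsGood E E' q ∧ q t = m t ∧ ∀ k, q k = m k ∨ q k = a k := by
  obtain ⟨q₁, hq₁, heq₁, hmix₁, hpast⟩ := Eventualities.exists_fulfilling_of_mixture hm.reverse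
    (fun k => h (-k)) ha.isThread.reverse hp.past ha.past (-t)
  have hq₁m (k : ℤ) : q₁ (-k) = m k ∨ q₁ (-k) = a k := by simpa using hmix₁ (-k)
  have hq₁p (k : ℤ) : q₁ (-k) = p k ∨ q₁ (-k) = a k :=
    (hq₁m k).elim (fun hk => hk ▸ h k) .inr
  obtain ⟨q, hq, heq, hmix, hfuture⟩ := Eventualities.exists_fulfilling_of_mixture hq₁.of_reverse
    hq₁p ha.isThread hp.future ha.future t
  refine ⟨q, ⟨hq, hfuture, Eventualities.fulfils_of_eq hq.reverse hpast (N := -t) fun k hk => ?_⟩,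
    ?_, fun k => ?_⟩
  · simpa using heq (-k) (by omega)
  · rw [heq t le_rfl, heq₁ _ le_rfl, neg_neg]
  · exact (hmix k).elim (fun hk => hk ▸ hq₁m k) .inr

theorem exists_le {p a : ℤ → α} (hp : IsGood E E' p) (ha : IsGood E E' a) {t : ℤ}
    (ht : p t ≤ a t) : ∃ q, IsGood E E' q ∧ q t = p t ∧ q ≤ a := by
  obtain ⟨q, hq, hqt, h⟩ := of_mixture (hp.isThread.inf ha.isThread) (fun k =>
    (hp.isThread.le_total ha.isThread k).imp inf_of_le_left inf_of_le_right) hp ha t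
  refine ⟨q, hq, hqt.trans (inf_of_le_left ht), fun k => ?_⟩
  exact (h k).elim (fun hk => hk.trans_le inf_le_right) le_of_eq

theorem exists_ge {p b : ℤ → α} (hp : IsGood E E' p) (hb : IsGood E E' b) {t : ℤ}
    (ht : b t ≤ p t) : ∃ q, IsGood E E' q ∧ q t = p t ∧ b ≤ q ∧ q ≤ p ⊔ b := by
  obtain ⟨q, hq, hqt, h⟩ := of_mixture (hp.isThread.sup hb.isThread) (fun k =>
    (hb.isThread.le_total hp.isThread k).imp sup_of_le_left sup_of_le_right) hp hb t
  refine ⟨q, hq, hqt.trans (sup_of_le_left ht), fun k => ?_, fun k => ?_⟩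
  · exact (h k).elim (fun hk => le_sup_right.trans_eq hk.symm) ge_of_eq
  · exact (h k).elim le_of_eq fun hk => hk.trans_le le_sup_right

variable {C : Set (ℤ → α)}

theorem exists_le_of_lt (hfin : C.Finite) (hC : IsChain (· ≤ ·) C)
    (hgood : ∀ p ∈ C, IsGood E E' p) {p : ℤ → α} (hp : IsGood E E' p) (t : ℤ) :
    ∃ q, IsGood E E' q ∧ q t = p t ∧ ∀ f ∈ C, p t < f t → q ≤ f := by
  rcases Set.eq_empty_or_nonempty {f ∈ C | p t < f t} with h | h
  · exact ⟨p, hp, rfl, fun f hf hlt => absurd ⟨hf, hlt⟩ (Set.eq_empty_iff_forall_notMem.1 h f)⟩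
  · obtain ⟨a, ⟨haC, ha⟩, hmin⟩ := (hfin.subset (Set.sep_subset C _)).exists_minimal h
    obtain ⟨q, hq, hqt, hqa⟩ := hp.exists_le (hgood a haC) ha.le
    exact ⟨q, hq, hqt, fun f hf hlt =>
      hqa.trans ((hC.total haC hf).elim id fun hfa => hmin ⟨hf, hlt⟩ hfa)⟩

theorem exists_ge_of_lt (hfin : C.Finite) (hC : IsChain (· ≤ ·) C)
    (hgood : ∀ p ∈ C, IsGood E E' p) {p : ℤ → α} (hp : IsGood E E' p) (t : ℤ) :
    ∃ q, IsGood E E' q ∧ q t = p t ∧ (∀ f ∈ C, f t < p t → f ≤ q) ∧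
      ∀ f ∈ C, p ≤ f → q ≤ f := by
  rcases Set.eq_empty_or_nonempty {f ∈ C | f t < p t} with h | h
  · exact ⟨p, hp, rfl, fun f hf hlt => absurd ⟨hf, hlt⟩ (Set.eq_empty_iff_forall_notMem.1 h f),
      fun _ _ => id⟩
  · obtain ⟨b, ⟨hbC, hb⟩, hmax⟩ := (hfin.subset (Set.sep_subset C _)).exists_maximal h
    obtain ⟨q, hq, hqt, hbq, hqpb⟩ := hp.exists_ge (hgood b hbC) hb.le
    refine ⟨q, hq, hqt, fun f hf hlt => ?_, fun f hf hpf => ?_⟩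
    · exact ((hC.total hf hbC).elim id fun hbf => hmax ⟨hf, hlt⟩ hbf).trans hbq
    · have hbf : b ≤ f := (hC.total hbC hf).resolve_right fun hfb =>
        (hb.trans_le (hpf t)).not_ge (hfb t)
      exact hqpb.trans (sup_le hpf hbf)

theorem exists_isChain_insert (hfin : C.Finite) (hC : IsChain (· ≤ ·) C)
    (hgood : ∀ p ∈ C, IsGood E E' p) {p : ℤ → α} (hp : IsGood E E' p) (t : ℤ) :
    ∃ q, IsGood E E' q ∧ q t = p t ∧ IsChain (· ≤ ·) (insert q C) := by
  by_cases hex : ∃ f ∈ C, f t = p t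
  · obtain ⟨f, hf, hft⟩ := hex
    exact ⟨f, hgood f hf, hft, by rwa [Set.insert_eq_of_mem hf]⟩
  push Not at hex
  obtain ⟨p₁, hp₁, hp₁t, habove⟩ := hp.exists_le_of_lt hfin hC hgood t
  obtain ⟨q, hq, hqt, hbelow, hkeep⟩ := hp₁.exists_ge_of_lt hfin hC hgood t
  refine ⟨q, hq, hqt.trans hp₁t, hC.insert fun f hf _ => ?_⟩
  obtain h | h := (hgood f hf).isThread.le_total hp.isThread t
  · exact .inr (hbelow f hf (hp₁t ▸ lt_of_le_of_ne h (hex f hf)))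
  · exact .inl (hkeep f hf (habove f hf (lt_of_le_of_ne' h (hex f hf))))

end IsGood

theorem exists_countable_chain (hD : ∀ k, (A.D k).Countable)
    (h : ∀ k, ∀ x ∈ A.D k, ∃ p, IsGood E E' p ∧ p k = x) :
    ∃ C : Set (ℤ → α), C.Countable ∧ IsChain (· ≤ ·) C ∧ (∀ p ∈ C, IsGood E E' p) ∧
      ∀ k, ∀ x ∈ A.D k, ∃ p ∈ C, p k = x := by
  rcases isEmpty_or_nonempty (Σ k, A.D k) with hempty | hnonempty
  · exact ⟨∅, Set.countable_empty, IsChain.empty, fun p hp => hp.elim,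
      fun k x hx => hempty.elim ⟨k, x, hx⟩⟩
  let GoodChain := {C : Set (ℤ → α) // C.Finite ∧ IsChain (· ≤ ·) C ∧ ∀ p ∈ C, IsGood E E' p}
  have hstep (C : GoodChain) (d : Σ k, A.D k) :
      ∃ C' : GoodChain, C.1 ⊆ C'.1 ∧ ∃ p ∈ C'.1, p d.1 = d.2 := by
    obtain ⟨C, hfin, hC, hgood⟩ := C
    obtain ⟨k, x, hx⟩ := d
    obtain ⟨p, hp, hpk⟩ := h k x hx
    obtain ⟨q, hq, hqk, hchain⟩ := hp.exists_isChain_insert hfin hC hgood k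
    exact ⟨⟨insert q C, hfin.insert q, hchain, Set.forall_mem_insert.2 ⟨hq, hgood⟩⟩,
      Set.subset_insert _ _, q, Set.mem_insert _ _, hqk.trans hpk⟩
  choose next hsub hnext using hstep
  have := fun k => (hD k).to_subtype
  obtain ⟨e, he⟩ := exists_surjective_nat (Σ k, A.D k)
  let s : ℕ → GoodChain := fun n =>
    Nat.rec ⟨∅, Set.finite_empty, IsChain.empty, by simp⟩ (fun n C => next C (e n)) n
  have hmono : Monotone fun n => (s n).1 := monotone_nat_of_le_succ fun n => hsub (s n) _
  refine ⟨⋃ n, (s n).1, Set.countable_iUnion fun n => (s n).2.1.countable, ?_, ?_, ?_⟩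
  · exact (Set.pairwise_iUnion hmono.directed_le).2 fun n => (s n).2.2.1
  · simpa only [Set.mem_iUnion, forall_exists_index] using fun p n => (s n).2.2.2 p
  · intro k x hx
    obtain ⟨n, hn⟩ := he ⟨k, x, hx⟩
    obtain ⟨p, hp, hpx⟩ := hnext (s n) (e n)
    rw [hn] at hpx
    exact ⟨p, Set.mem_iUnion.2 ⟨n + 1, hp⟩, hpx⟩

end Good

end ThreadSystem

/-! ### Unrolling a witness -/

theorem Moment.exists_ge_of_imp_notMem {Sg Φ : Set Formula} {m : Moment Sg} (hΦ : Φ ∈ m.carrier)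
    {φ ψ : Formula} (h : Formula.imp φ ψ ∈ Sg \ Φ) : ∃ Ψ ∈ m.carrier, Φ ≤ Ψ ∧ φ ∈ Ψ ∧ ψ ∉ Ψ := by
  obtain ⟨a, rfl⟩ := hΦ
  obtain ⟨b, hb, hdefect⟩ := m.imp_defect a φ ψ h
  exact ⟨_, ⟨b, rfl⟩, m.lab_strictAnti.antitone hb, hdefect⟩

theorem Moment.exists_le_of_coimp_mem {Sg Φ : Set Formula} {m : Moment Sg} (hΦ : Φ ∈ m.carrier)
    {φ ψ : Formula} (h : Formula.coimp φ ψ ∈ Φ) : ∃ Ψ ∈ m.carrier, Ψ ≤ Φ ∧ φ ∈ Ψ ∧ ψ ∉ Ψ := by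
  obtain ⟨a, rfl⟩ := hΦ
  obtain ⟨b, hb, hdefect⟩ := m.coimp_defect a φ ψ h
  exact ⟨_, ⟨b, rfl⟩, m.lab_strictAnti.antitone hb, hdefect⟩

namespace IsTemporalStep

variable {Sg : Set Formula} {m n : Moment Sg} {R : Set Formula → Set Formula → Prop}
  (h : IsTemporalStep m n R)
include h

theorem exists_right {Φ : Set Formula} (hΦ : Φ ∈ m.carrier) : ∃ Ψ, R Φ Ψ := by
  obtain ⟨a, rfl⟩ := hΦ
  obtain ⟨Φ', Ψ', hR⟩ := h.nonempty
  obtain ⟨⟨a', rfl⟩, b', rfl⟩ := h.subset _ _ hR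
  obtain ha | ha := le_total a a'
  · obtain ⟨b, hb, -⟩ := h.confluent.forth_down a a' b' ha hR
    exact ⟨_, hb⟩
  · obtain ⟨b, hb, -⟩ := h.confluent.forth_up a' a b' ha hR
    exact ⟨_, hb⟩

theorem exists_left {Ψ : Set Formula} (hΨ : Ψ ∈ n.carrier) : ∃ Φ, R Φ Ψ := by
  obtain ⟨b, rfl⟩ := hΨ
  obtain ⟨Φ', Ψ', hR⟩ := h.nonempty
  obtain ⟨⟨a', rfl⟩, b', rfl⟩ := h.subset _ _ hR
  obtain hb | hb := le_total b b'
  · obtain ⟨a, -, ha⟩ := h.confluent.back_down a' b b' hR hb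
    exact ⟨_, ha⟩
  · obtain ⟨a, -, ha⟩ := h.confluent.back_up a' b' b hR hb
    exact ⟨_, ha⟩

theorem uncross {Φ Φ' Ψ Ψ' : Set Formula} (h₁ : R Φ Ψ) (h₂ : R Φ' Ψ') (hΦ : Φ ≤ Φ')
    (hΨ : Ψ' ≤ Ψ) : R Φ Ψ' ∧ R Φ' Ψ := by
  obtain ⟨⟨a, rfl⟩, b, rfl⟩ := h.subset _ _ h₁
  obtain ⟨⟨a', rfl⟩, b', rfl⟩ := h.subset _ _ h₂
  replace hΦ := m.lab_strictAnti.le_iff_ge.1 hΦ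
  replace hΨ := n.lab_strictAnti.le_iff_ge.1 hΨ
  obtain ⟨c, hc, hcb⟩ := h.confluent.forth_down a' a b hΦ h₁
  obtain ⟨d, hd, hdb⟩ := h.confluent.forth_up a' a b' hΦ h₂
  exact ⟨(h.convex.image a).out h₁ hd ⟨hΨ, hdb⟩, (h.convex.image a').out hc h₂ ⟨hcb, hΨ⟩⟩

end IsTemporalStep

theorem exists_ge_apply_eq_of_isChain {ι α : Type*} [PartialOrder α] {C : Set (ι → α)}
    (hC : IsChain (· ≤ ·) C) {τ : ι → α} (hτ : τ ∈ C) {k : ι} {x : α} (hx : ∃ σ ∈ C, σ k = x)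
    (hle : τ k ≤ x) : ∃ σ ∈ C, τ ≤ σ ∧ σ k = x := by
  obtain ⟨σ, hσ, rfl⟩ := hx
  obtain h | h := hC.total hτ hσ
  · exact ⟨σ, hσ, h, rfl⟩
  · exact ⟨τ, hτ, le_rfl, hle.antisymm (h k)⟩

theorem exists_le_apply_eq_of_isChain {ι α : Type*} [PartialOrder α] {C : Set (ι → α)}
    (hC : IsChain (· ≤ ·) C) {τ : ι → α} (hτ : τ ∈ C) {k : ι} {x : α} (hx : ∃ σ ∈ C, σ k = x)
    (hle : x ≤ τ k) : ∃ σ ∈ C, σ ≤ τ ∧ σ k = x :=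
  exists_ge_apply_eq_of_isChain (α := αᵒᵈ) hC.symm hτ hx hle

theorem emod_add_one_cases (a : ℤ) {l : ℤ} (hl : 0 < l) :
    (a + 1) % l = a % l + 1 ∨ ((a + 1) % l = 0 ∧ a % l + 1 = l) := by
  have hnonneg := Int.emod_nonneg a hl.ne'
  have hlt := Int.emod_lt_of_pos a hl
  have hmod : (a + 1) % l = (a % l + 1) % l := by rw [Int.emod_add_emod]
  obtain h | h := (show a % l + 1 ≤ l by omega).lt_or_eq
  · exact .inl (by rw [hmod, Int.emod_eq_of_lt (by omega) h])
  · exact .inr ⟨by rw [hmod, h, Int.emod_self], h⟩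

namespace SmallWitness

variable {Sg : Set Formula} {φ : Formula} (w : SmallWitness Sg φ)

/-- The moment at position `k`; the value outside the range of the witness is irrelevant. -/
noncomputable def momAt (k : ℤ) : Moment Sg :=
  if h : k ∈ Set.Icc (-(w.i' : ℤ) - w.l') (w.i + w.l) then w.mom ⟨k, h⟩
  else w.mom ⟨0, by constructor <;> omega⟩

/-- The relation at position `k`, empty outside the range of the witness. -/
def relAt (k : ℤ) (Φ Ψ : Set Formula) : Prop :=
  ∃ h : k ∈ Set.Ico (-(w.i' : ℤ) - w.l') (w.i + w.l), w.rel ⟨k, h⟩ Φ Ψ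

theorem momAt_eq {k : ℤ} (h : k ∈ Set.Icc (-(w.i' : ℤ) - w.l') (w.i + w.l)) :
    w.momAt k = w.mom ⟨k, h⟩ := dif_pos h

theorem relAt_eq {k : ℤ} (h : k ∈ Set.Ico (-(w.i' : ℤ) - w.l') (w.i + w.l)) :
    w.relAt k = w.rel ⟨k, h⟩ := by
  ext Φ Ψ
  exact exists_prop_of_true h

theorem isTemporalStep_relAt {k : ℤ} (h : k ∈ Set.Ico (-(w.i' : ℤ) - w.l') (w.i + w.l)) :
    IsTemporalStep (w.momAt k) (w.momAt (k + 1)) (w.relAt k) := by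
  rw [w.relAt_eq h, w.momAt_eq ⟨h.1, h.2.le⟩, w.momAt_eq (by constructor <;> grind)]
  exact w.step _ h.1 h.2

theorem momAt_past_loop : w.momAt (-w.i' - w.l') = w.momAt (-w.i') := by
  rw [w.momAt_eq (by constructor <;> omega), w.momAt_eq (by constructor <;> omega)]
  exact w.past_loop.symm

theorem momAt_future_loop : w.momAt (w.i + w.l) = w.momAt w.i := by
  rw [w.momAt_eq (by constructor <;> omega), w.momAt_eq (by constructor <;> omega)]
  exact w.future_loop.symm

/-- The position in a witness of the step that is used at time `k` in its unrolling, where both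
loops are repeated forever. -/
def fold (k : ℤ) : ℤ :=
  if w.i ≤ k then w.i + (k - w.i) % w.l
  else if k < -w.i' then -w.i' - (-w.i' - k - 1) % w.l' - 1
  else k

theorem fold_mem (k : ℤ) : w.fold k ∈ Set.Ico (-(w.i' : ℤ) - w.l') (w.i + w.l) := by
  have hl : (0 : ℤ) < w.l := by exact_mod_cast w.l_pos
  have hl' : (0 : ℤ) < w.l' := by exact_mod_cast w.l'_pos
  have := Int.emod_nonneg (k - w.i) hl.ne'
  have := Int.emod_lt_of_pos (k - w.i) hl
  have := Int.emod_nonneg (-w.i' - k - 1) hl'.ne'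
  have := Int.emod_lt_of_pos (-w.i' - k - 1) hl'
  rw [fold, Set.mem_Ico]
  split_ifs <;> omega

theorem fold_of_mem {k : ℤ} (hk : k ∈ Set.Icc (-(w.i' : ℤ)) w.i) : w.fold k = k := by
  obtain ⟨hpast, hfuture⟩ := hk
  rw [fold]
  split_ifs with h h'
  · rw [show k = w.i by omega, sub_self, Int.zero_emod, add_zero]
  · omega
  · rfl

theorem fold_future (c : ℕ) {r : ℕ} (hr : r < w.l) :
    w.fold (w.i + c * w.l + r) = w.i + r := by
  have hmul : (w.i + c * w.l + r - w.i : ℤ) = r + w.l * c := by ring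
  have hnonneg : (0 : ℤ) ≤ c * w.l := by positivity
  rw [fold, if_pos (by omega), hmul, Int.add_mul_emod_self_left,
    Int.emod_eq_of_lt (by omega) (by omega)]

theorem fold_past (c : ℕ) {r : ℕ} (hr : r < w.l') :
    w.fold (-(w.i' + c * w.l' + r) - 1) = -w.i' - r - 1 := by
  have hmul : (-w.i' - (-(w.i' + c * w.l' + r) - 1) - 1 : ℤ) = r + w.l' * c := by ring
  have hnonneg : (0 : ℤ) ≤ c * w.l' := by positivity
  rw [fold, if_neg (by omega), if_pos (by omega), hmul, Int.add_mul_emod_self_left,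
    Int.emod_eq_of_lt (by omega) (by omega)]

theorem momAt_fold_add_one_of_future {k : ℤ} (hk : w.i ≤ k) :
    w.momAt (w.fold k + 1) = w.momAt (w.fold (k + 1)) := by
  rw [fold, fold, if_pos hk, if_pos (by omega), add_sub_right_comm, add_assoc]
  obtain h | ⟨h, hend⟩ := emod_add_one_cases (k - w.i) (Int.natCast_pos.2 w.l_pos)
  · rw [h]
  · rw [h, hend, add_zero, w.momAt_future_loop]

theorem momAt_fold_add_one_of_past {k : ℤ} (hk : k + 1 < -w.i') :
    w.momAt (w.fold k + 1) = w.momAt (w.fold (k + 1)) := by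
  have hmod : -(w.i' : ℤ) - k - 1 = -w.i' - (k + 1) - 1 + 1 := by ring
  rw [fold, fold, if_neg (by omega), if_pos (by omega), if_neg (by omega), if_pos hk, hmod]
  obtain h | ⟨h, hend⟩ := emod_add_one_cases (-w.i' - (k + 1) - 1) (Int.natCast_pos.2 w.l'_pos)
  · rw [h]; congr 1; ring
  · rw [h, sub_sub _ (_ % _) (1 : ℤ), hend, sub_zero, sub_add_cancel, w.momAt_past_loop]

theorem momAt_fold_add_one (k : ℤ) : w.momAt (w.fold k + 1) = w.momAt (w.fold (k + 1)) := by
  obtain hk | hk | hk | hk : w.i ≤ k ∨ k + 1 < -w.i' ∨ k = -w.i' - 1 ∨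
      -w.i' ≤ k ∧ k < w.i := by omega
  · exact w.momAt_fold_add_one_of_future hk
  · exact w.momAt_fold_add_one_of_past hk
  · have := w.fold_past 0 w.l'_pos
    rw [w.fold_of_mem (k := k + 1) (by constructor <;> omega), hk]
    simpa using congrArg (fun j => w.momAt (j + 1)) this
  · rw [w.fold_of_mem ⟨hk.1, hk.2.le⟩, w.fold_of_mem ⟨by omega, by omega⟩]

theorem momAt_fold_future (c : ℕ) : w.momAt (w.fold (w.i + c * w.l)) = w.momAt w.i := by
  simpa using congrArg w.momAt (w.fold_future c w.l_pos)

theorem momAt_fold_past (c : ℕ) : w.momAt (w.fold (-(w.i' + c * w.l'))) = w.momAt (-w.i') := by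
  have h := w.momAt_fold_add_one (-(w.i' + c * w.l' + (0 : ℕ)) - 1)
  rw [w.fold_past c w.l'_pos] at h
  simpa using h.symm

theorem isTemporalStep_fold (k : ℤ) :
    IsTemporalStep (w.momAt (w.fold k)) (w.momAt (w.fold (k + 1))) (w.relAt (w.fold k)) := by
  rw [← w.momAt_fold_add_one]
  exact w.isTemporalStep_relAt (w.fold_mem k)

/-- The bi-infinite system of types and steps obtained by repeating both loops of a witness. -/
noncomputable def unroll : ThreadSystem (Set Formula) where
  D k := (w.momAt (w.fold k)).carrier
  R k := w.relAt (w.fold k)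
  chain _ := (Moment.lab_strictAnti _).antitone.isChain_range
  mem_left h := ((w.isTemporalStep_fold _).subset _ _ h).1
  mem_right h := ((w.isTemporalStep_fold _).subset _ _ h).2
  serial k _ hΦ := (w.isTemporalStep_fold k).exists_right hΦ
  coserial k _ hΨ := (w.isTemporalStep_fold k).exists_left hΨ
  uncross := (w.isTemporalStep_fold _).uncross

theorem exists_mem_unroll_notMem : ∃ Φ ∈ w.unroll.D 0, φ ∉ Φ := by
  simp only [unroll, w.fold_of_mem (k := 0) (by constructor <;> omega),
    w.momAt_eq (k := 0) (by constructor <;> omega)]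
  exact w.falsifies

theorem countable_unroll (k : ℤ) : (w.unroll.D k).Countable := Set.countable_range _

theorem isTrace_of_isThread {τ : ℤ → Set Formula} (hτ : w.unroll.IsThread τ) : IsTrace Sg τ where
  subset k := by
    obtain ⟨a, ha⟩ := hτ.mem k
    exact ha ▸ (Moment.isType _ a).subset
  sensible k := (w.isTemporalStep_fold k).sensible _ _ (hτ k)

/-- The eventualities given by the until- and `G`-formulas. -/
def futureEventualities : w.unroll.Eventualities {o ∈ Sg | o.dir = 1} where
  pend o := Pending Sg o
  done o := Fulfilled o
  persist {o _ _ _} h hpend :=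
    ((((w.isTemporalStep_fold _).sensible _ _ h).pending_iff o.2.1 o.2.2).1 hpend).imp_right
      And.right

/-- The eventualities given by the since- and `H`-formulas. -/
def pastEventualities : w.unroll.reverse.Eventualities {o ∈ Sg | o.dir = -1} where
  pend o := Pending Sg o
  done o := Fulfilled o
  persist {o k _ _} h hpend :=
    ((((w.isTemporalStep_fold (-k - 1)).sensible _ _ h).pending_iff_of_past o.2.1 o.2.2).1
      hpend).imp_right And.right

theorem exists_future_path {Φ : Set Formula} (hΦ : Φ ∈ (w.momAt w.i).carrier) {o : Formula}
    (hdir : o.dir = 1) (ho : Pending Sg o Φ) : ∃ r < w.l, ∃ P : ℕ → Set Formula, P 0 = Φ ∧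
      (∀ k < r, w.relAt (w.i + k) (P k) (P (k + 1))) ∧ Fulfilled o (P r) := by
  rw [w.momAt_eq (by constructor <;> omega)] at hΦ
  cases o with
  | U α β =>
    obtain ⟨r, hr, P, hP, hstep, hβ⟩ := w.until_realised Φ hΦ α β ho
    exact ⟨r, hr, P, hP, fun k hk => ⟨_, (hstep k hk).1⟩, hβ⟩
  | G β =>
    obtain ⟨r, hr, P, hP, hstep, hβ⟩ := w.G_realised Φ hΦ β ho
    exact ⟨r, hr, P, hP, fun k hk => ⟨_, hstep k hk⟩, hβ⟩
  | H | S => simp [Formula.dir] at hdir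
  | _ => exact ho.elim

theorem exists_past_path {Φ : Set Formula} (hΦ : Φ ∈ (w.momAt (-w.i')).carrier) {o : Formula}
    (hdir : o.dir = -1) (ho : Pending Sg o Φ) : ∃ r < w.l', ∃ P : ℕ → Set Formula, P 0 = Φ ∧
      (∀ k < r, w.relAt (-w.i' - k - 1) (P (k + 1)) (P k)) ∧ Fulfilled o (P r) := by
  rw [w.momAt_eq (by constructor <;> omega)] at hΦ
  cases o with
  | S α β =>
    obtain ⟨r, hr, P, hP, hstep, hβ⟩ := w.since_realised Φ hΦ α β ho
    exact ⟨r, hr, P, hP, fun k hk => ⟨_, (hstep k hk).1⟩, hβ⟩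
  | H β =>
    obtain ⟨r, hr, P, hP, hstep, hβ⟩ := w.H_realised Φ hΦ β ho
    exact ⟨r, hr, P, hP, fun k hk => ⟨_, hstep k hk⟩, hβ⟩
  | _ => simp [Formula.dir] at hdir

theorem le_add_toNat_mul (k : ℤ) (i : ℕ) {l : ℕ} (hl : 0 < l) : k ≤ i + k.toNat * l := by
  have : (1 : ℤ) ≤ l := by exact_mod_cast hl
  nlinarith [Int.self_le_toNat k]

open ThreadSystem.Eventualities in
theorem futureEventualities_realisableAt (k : ℤ) : w.futureEventualities.RealisableAt k := by
  refine .of_le (le_add_toNat_mul k w.i w.l_pos) (realisableAt_of_path fun o Φ hΦ ho => ?_)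
  obtain ⟨r, hr, P, hP, hstep, hdone⟩ :=
    w.exists_future_path (w.momAt_fold_future k.toNat ▸ hΦ) o.2.2 ho
  refine ⟨r, P, hP, fun j hj => ?_, hdone⟩
  simpa only [unroll, w.fold_future _ (hj.trans hr)] using hstep j hj

open ThreadSystem.Eventualities in
theorem pastEventualities_realisableAt (k : ℤ) : w.pastEventualities.RealisableAt k := by
  refine .of_le (le_add_toNat_mul k w.i' w.l'_pos) (realisableAt_of_path fun o Φ hΦ ho => ?_)
  obtain ⟨r, hr, P, hP, hstep, hdone⟩ :=
    w.exists_past_path (w.momAt_fold_past k.toNat ▸ hΦ) o.2.2 ho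
  refine ⟨r, P, hP, fun j hj => ?_, hdone⟩
  simpa only [ThreadSystem.reverse, unroll, w.fold_past _ (hj.trans hr)] using hstep j hj

/-- A thread of the unrolled witness that fulfils all its eventualities. -/
def IsGoodThread (τ : ℤ → Set Formula) : Prop :=
  ThreadSystem.IsGood w.futureEventualities w.pastEventualities τ

variable {w} in
theorem IsGoodThread.realises {τ : ℤ → Set Formula} (hτ : w.IsGoodThread τ) {o : Formula} {k : ℤ}
    (ho : Pending Sg o (τ k)) : Realises τ o k := by
  have htrace := w.isTrace_of_isThread hτ.isThread
  have hmem := ho.mem (htrace.subset k)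
  obtain hdir | hdir := o.dir_eq_one_or_neg_one
  · obtain ⟨n, hn, hdone⟩ := hτ.future ⟨o, hmem, hdir⟩ k ho
    refine htrace.realises_of_fulfilled ho (r := (n - k).toNat) ?_
    rwa [hdir, Int.toNat_of_nonneg (by omega), one_mul, add_sub_cancel]
  · obtain ⟨n, hn, hdone⟩ := hτ.past ⟨o, hmem, hdir⟩ (-k)
      (show Pending Sg o (τ (- -k)) by rwa [neg_neg])
    refine htrace.realises_of_fulfilled ho (r := (n + k).toNat) ?_
    rwa [hdir, Int.toNat_of_nonneg (by omega), neg_one_mul, neg_add_rev, add_neg_cancel_left]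

theorem exists_countable_chain_isGoodThread (hSg : Sg.Countable) :
    ∃ C : Set (ℤ → Set Formula), C.Countable ∧ IsChain (· ≤ ·) C ∧ (∀ τ ∈ C, w.IsGoodThread τ) ∧
      ∀ k, ∀ Φ ∈ w.unroll.D k, ∃ τ ∈ C, τ k = Φ := by
  have := (hSg.mono (Set.sep_subset Sg fun o => o.dir = 1)).to_subtype
  have := (hSg.mono (Set.sep_subset Sg fun o => o.dir = -1)).to_subtype
  exact ThreadSystem.exists_countable_chain w.countable_unroll fun k Φ =>
    ThreadSystem.exists_isGood w.futureEventualities_realisableAt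
      w.pastEventualities_realisableAt

include w in
theorem exists_typeFlow (hSg : Sg.Countable) : ∃ (W : Type) (_ : LinearOrder W) (_ : Countable W)
    (F : TypeFlow Sg W), F.Exact ∧ ∃ v, φ ∉ F.ty 0 v := by
  classical
  obtain ⟨C, hcount, hchain, hgood, hcover⟩ := w.exists_countable_chain_isGoodThread hSg
  let _ : LinearOrder C := { (inferInstance : PartialOrder C) with
    le_total := fun σ τ => hchain.total σ.2 τ.2
    toDecidableLE := Classical.decRel _ }
  have htrace (τ : C) : IsTrace Sg τ.1 := w.isTrace_of_isThread (hgood τ τ.2).isThread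
  -- Types shrink as the point of a flow grows, so the order of the threads has to be reversed.
  let F : TypeFlow Sg Cᵒᵈ := {
    ty := fun k τ => τ.ofDual.1 k
    anti := fun k σ τ h => h k
    isType := fun k τ => by
      obtain ⟨a, ha⟩ := (hgood _ τ.ofDual.2).isThread.mem k
      exact ha ▸ Moment.isType _ a
    imp_defect := fun k τ α β h => by
      obtain ⟨Ψ, hΨ, hle, hα, hβ⟩ :=
        Moment.exists_ge_of_imp_notMem ((hgood _ τ.ofDual.2).isThread.mem k) h
      obtain ⟨σ, hσ, hτσ, rfl⟩ :=
        exists_ge_apply_eq_of_isChain hchain τ.ofDual.2 (hcover k Ψ hΨ) hle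
      exact ⟨.toDual ⟨σ, hσ⟩, hτσ, hα, hβ⟩
    coimp_defect := fun k τ α β h => by
      obtain ⟨Ψ, hΨ, hle, hα, hβ⟩ :=
        Moment.exists_le_of_coimp_mem ((hgood _ τ.ofDual.2).isThread.mem k) h
      obtain ⟨σ, hσ, hστ, rfl⟩ :=
        exists_le_apply_eq_of_isChain hchain τ.ofDual.2 (hcover k Ψ hΨ) hle
      exact ⟨.toDual ⟨σ, hσ⟩, hστ, hα, hβ⟩
    sensible := fun k τ => (htrace τ.ofDual).sensible k }
  obtain ⟨Φ, hΦ, hφ⟩ := w.exists_mem_unroll_notMem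
  obtain ⟨τ, hτ, rfl⟩ := hcover 0 Φ hΦ
  exact ⟨Cᵒᵈ, inferInstance, hcount.to_subtype, F, fun o k τ h => (hgood _ τ.ofDual.2).realises h,
    .toDual ⟨τ, hτ⟩, hφ⟩

end SmallWitness

/-! ### From exact flows of types to bi-relational models -/

/-- The truth set of a formula in a bi-relational frame, for an interpretation `I` of the
variables. -/
def eval {W : Type*} [LinearOrder W] {T : Type*} (S : Equiv.Perm T) (I : ℕ → Set (W × T)) :
    Formula → Set (W × T)
  | .var p => I p
  | .and φ ψ => eval S I φ ∩ eval S I ψ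
  | .or φ ψ => eval S I φ ∪ eval S I ψ
  | .imp φ ψ => {x | ∀ v ≤ x.1, (v, x.2) ∈ eval S I φ → (v, x.2) ∈ eval S I ψ}
  | .coimp φ ψ => {x | ∃ v ≥ x.1, (v, x.2) ∈ eval S I φ ∧ (v, x.2) ∉ eval S I ψ}
  | .X φ => step W S ⁻¹' eval S I φ
  | .Y φ => step W S '' eval S I φ
  | .G φ => ⋂ n : ℕ, (step W S)^[n] ⁻¹' eval S I φ
  | .H φ => ⋂ n : ℕ, (step W S)^[n] '' eval S I φ
  | .U φ ψ => ⋃ n : ℕ, (⋂ k < n, (step W S)^[k] ⁻¹' eval S I φ) ∩ (step W S)^[n] ⁻¹' eval S I ψ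
  | .S φ ψ => ⋃ n : ℕ, (⋂ k < n, (step W S)^[k] '' eval S I φ) ∩ (step W S)^[n] '' eval S I ψ

/-- The bi-relational valuation extending an interpretation of the variables by downward closed
sets. -/
def evalValuation {W : Type*} [LinearOrder W] {T : Type*} (S : Equiv.Perm T) (I : ℕ → Set (W × T))
    (hI : ∀ p w v t, v ≤ w → (w, t) ∈ I p → (v, t) ∈ I p) : RelValuation W S where
  val := eval S I
  var_down := hI
  and_eq _ _ := rfl
  or_eq _ _ := rfl
  imp_eq _ _ := rfl
  coimp_eq _ _ := rfl
  X_eq _ := rfl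
  Y_eq _ := rfl
  G_eq _ := rfl
  H_eq _ := rfl
  U_eq _ _ := rfl
  S_eq _ _ := rfl

/-- The successor map of the integers, as a flow in an arbitrary universe. -/
def intShift : Equiv.Perm (ULift.{u} ℤ) where
  toFun k := ⟨k.down + 1⟩
  invFun k := ⟨k.down - 1⟩
  left_inv k := by ext; simp
  right_inv k := by ext; simp

theorem intShift_apply (k : ULift.{u} ℤ) : intShift k = ⟨k.down + 1⟩ := rfl

theorem intShift_inv_apply (k : ULift.{u} ℤ) : intShift⁻¹ k = ⟨k.down - 1⟩ := rfl

theorem intShift_pow_apply (n : ℕ) (k : ULift.{u} ℤ) : (intShift ^ n) k = ⟨k.down + n⟩ := by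
  induction n with
  | zero => ext; simp
  | succ n ih =>
    rw [pow_succ', Equiv.Perm.mul_apply, ih, intShift_apply]
    ext
    push_cast
    ring

theorem intShift_inv_pow_apply (n : ℕ) (k : ULift.{u} ℤ) :
    (intShift⁻¹ ^ n) k = ⟨k.down - n⟩ := by
  induction n with
  | zero => ext; simp
  | succ n ih =>
    rw [pow_succ', Equiv.Perm.mul_apply, ih, intShift_inv_apply]
    ext
    push_cast
    ring

namespace TypeFlow

variable {Sg : Set Formula} {W : Type*} [LinearOrder W] (F : TypeFlow Sg W)

/-- The flow of types obtained by transport along an order isomorphism. -/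
def comap {V : Type*} [LinearOrder V] (e : V ≃o W) : TypeFlow Sg V where
  ty k v := F.ty k (e v)
  anti k := (F.anti k).comp_monotone e.monotone
  isType k v := F.isType k (e v)
  imp_defect k v φ ψ h := by
    obtain ⟨w, hw, hdef⟩ := F.imp_defect k (e v) φ ψ h
    exact ⟨e.symm w, e.symm_apply_le.2 hw, by rwa [e.apply_symm_apply]⟩
  coimp_defect k v φ ψ h := by
    obtain ⟨w, hw, hdef⟩ := F.coimp_defect k (e v) φ ψ h
    exact ⟨e.symm w, e.le_symm_apply.2 hw, by rwa [e.apply_symm_apply]⟩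
  sensible k v := F.sensible k (e v)

theorem Exact.comap {F : TypeFlow Sg W} (hF : F.Exact) {V : Type*} [LinearOrder V]
    (e : V ≃o W) : (F.comap e).Exact :=
  fun o k v => hF o k (e v)

theorem imp_mem_iff {φ ψ : Formula} (h : Formula.imp φ ψ ∈ Sg) (k : ℤ) (w : W) :
    .imp φ ψ ∈ F.ty k w ↔ ∀ v ≤ w, φ ∈ F.ty k v → ψ ∈ F.ty k v := by
  constructor
  · intro himp v hv hφ
    exact ((F.isType k v).imp_elim φ ψ h (F.anti k hv himp)).resolve_left (not_not.2 hφ)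
  · intro hall
    by_contra himp
    obtain ⟨v, hv, hφ, hψ⟩ := F.imp_defect k w φ ψ ⟨h, himp⟩
    exact hψ (hall v hv hφ)

theorem coimp_mem_iff {φ ψ : Formula} (h : Formula.coimp φ ψ ∈ Sg) (k : ℤ) (w : W) :
    .coimp φ ψ ∈ F.ty k w ↔ ∃ v ≥ w, φ ∈ F.ty k v ∧ ψ ∉ F.ty k v := by
  constructor
  · exact F.coimp_defect k w φ ψ
  · rintro ⟨v, hv, hφ, hψ⟩
    exact F.anti k hv ((F.isType k v).coimp_intro φ ψ h hφ hψ)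

variable {F}

theorem Exact.pending_iff (hF : F.Exact) {o : Formula} (ho : o ∈ Sg) (k : ℤ) (w : W) :
    Pending Sg o (F.ty k w) ↔ Realises (F.ty · w) o k :=
  ⟨hF o k w, (F.isTrace w).pending_of_realises ho⟩

theorem Exact.G_mem_iff (hF : F.Exact) {β : Formula} (h : Formula.G β ∈ Sg) (k : ℤ) (w : W) :
    .G β ∈ F.ty k w ↔ ∀ n : ℕ, β ∈ F.ty (k + n) w := by
  simpa only [Pending, Realises, RealisesAfter, Holding, Fulfilled, Formula.dir, one_mul,
    Set.mem_sdiff, h, true_and, implies_true, ← not_forall, not_iff_not] using hF.pending_iff h k w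

theorem Exact.H_mem_iff (hF : F.Exact) {β : Formula} (h : Formula.H β ∈ Sg) (k : ℤ) (w : W) :
    .H β ∈ F.ty k w ↔ ∀ n : ℕ, β ∈ F.ty (k - n) w := by
  simpa only [Pending, Realises, RealisesAfter, Holding, Fulfilled, Formula.dir, neg_one_mul,
    ← sub_eq_add_neg, Set.mem_sdiff, h, true_and, implies_true, ← not_forall, not_iff_not]
    using hF.pending_iff h k w

theorem Exact.U_mem_iff (hF : F.Exact) {α β : Formula} (h : Formula.U α β ∈ Sg) (k : ℤ) (w : W) :
    .U α β ∈ F.ty k w ↔ ∃ n : ℕ, (∀ j < n, α ∈ F.ty (k + j) w) ∧ β ∈ F.ty (k + n) w := by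
  simpa only [Pending, Realises, RealisesAfter, Holding, Fulfilled, Formula.dir, one_mul]
    using hF.pending_iff h k w

theorem Exact.S_mem_iff (hF : F.Exact) {α β : Formula} (h : Formula.S α β ∈ Sg) (k : ℤ) (w : W) :
    .S α β ∈ F.ty k w ↔ ∃ n : ℕ, (∀ j < n, α ∈ F.ty (k - j) w) ∧ β ∈ F.ty (k - n) w := by
  simpa only [Pending, Realises, RealisesAfter, Holding, Fulfilled, Formula.dir, neg_one_mul,
    ← sub_eq_add_neg] using hF.pending_iff h k w

variable (F) in
/-- The bi-relational valuation on the flow of the integers that makes a variable true where it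
belongs to the type. -/
def relValuation : RelValuation W intShift.{u} :=
  evalValuation intShift (fun p => {x | Formula.var p ∈ F.ty x.2.down x.1})
    fun _ _ _ t h hx => F.anti t.down h hx

theorem Exact.mem_relValuation_iff (hF : F.Exact) (hsub : SubformulaClosed Sg) {φ : Formula}
    (hφ : φ ∈ Sg) (w : W) (t : ULift.{u} ℤ) :
    (w, t) ∈ F.relValuation.val φ ↔ φ ∈ F.ty t.down w := by
  induction φ generalizing w t with
  | var p => rfl
  | and φ ψ ihφ ihψ =>
    rw [F.relValuation.and_eq, (F.isType _ _).and_iff _ _ hφ, Set.mem_inter_iff,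
      ihφ (hsub.mem hφ), ihψ (hsub.mem hφ)]
  | or φ ψ ihφ ihψ =>
    rw [F.relValuation.or_eq, (F.isType _ _).or_iff _ _ hφ, Set.mem_union,
      ihφ (hsub.mem hφ), ihψ (hsub.mem hφ)]
  | imp φ ψ ihφ ihψ =>
    rw [F.relValuation.imp_eq, F.imp_mem_iff hφ, Set.mem_ofPred_eq]
    simp only [ihφ (hsub.mem hφ), ihψ (hsub.mem hφ)]
  | coimp φ ψ ihφ ihψ =>
    rw [F.relValuation.coimp_eq, F.coimp_mem_iff hφ, Set.mem_ofPred_eq]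
    simp only [ihφ (hsub.mem hφ), ihψ (hsub.mem hφ)]
  | X φ ih =>
    rw [F.relValuation.mem_X, ih (hsub.mem hφ), intShift_apply, (F.sensible _ w).X_iff φ hφ]
  | Y φ ih =>
    rw [F.relValuation.mem_Y, ih (hsub.mem hφ), intShift_inv_apply,
      ← (F.sensible _ w).Y_iff φ hφ, sub_add_cancel]
  | G φ ih =>
    simp only [F.relValuation.mem_G, hF.G_mem_iff hφ, ih (hsub.mem hφ), intShift_pow_apply]
  | H φ ih =>
    simp only [F.relValuation.mem_H, hF.H_mem_iff hφ, ih (hsub.mem hφ), intShift_inv_pow_apply]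
  | U φ ψ ihφ ihψ =>
    simp only [F.relValuation.mem_U, hF.U_mem_iff hφ, ihφ (hsub.mem hφ), ihψ (hsub.mem hφ),
      intShift_pow_apply]
  | S φ ψ ihφ ihψ =>
    simp only [F.relValuation.mem_S, hF.S_mem_iff hφ, ihφ (hsub.mem hφ), ihψ (hsub.mem hφ),
      intShift_inv_pow_apply]

end TypeFlow

/-! ### Real models from countable bi-relational models -/

open MeasureTheory in
theorem exists_isProbabilityMeasure_singleton_pos (W : Type*) [MeasurableSpace W]
    [MeasurableSingletonClass W] [Countable W] [Nonempty W] :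
    ∃ μ : Measure W, IsProbabilityMeasure μ ∧ ∀ w, 0 < μ {w} := by
  obtain ⟨ε, hε, hsum⟩ := ENNReal.exists_pos_sum_of_countable one_ne_zero W
  have hne : ∑' w, (ε w : ENNReal) ≠ 0 := by
    obtain ⟨w⟩ := ‹Nonempty W›
    exact fun h => (hε w).ne' (by simpa using ENNReal.tsum_eq_zero.1 h w)
  let p : PMF W := PMF.normalize (fun w => ε w) hne (hsum.trans ENNReal.one_lt_top).ne
  refine ⟨p.toMeasure, inferInstance, fun w => ?_⟩
  rw [p.toMeasure_apply_singleton _ (measurableSet_singleton w), pos_iff_ne_zero,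
    ← PMF.mem_support_iff, PMF.mem_support_normalize_iff]
  exact_mod_cast (hε w).ne'

section Weight

variable {W : Type*} [LinearOrder W]

/-- A map from the subsets of `W` to the unit interval that embeds the chain of lower sets and
preserves the countable meets and joins of that chain; it turns truth sets into truth values. -/
structure IsWeight (g : Set W → unitInterval) : Prop where
  map_empty : g ∅ = 0
  map_univ : g Set.univ = 1
  strictMono : StrictMono g
  map_iInter : ∀ A : ℕ → Set W, (∀ n, IsLowerSet (A n)) → g (⋂ n, A n) = ⨅ n, g (A n)
  map_iUnion : ∀ A : ℕ → Set W, (∀ n, IsLowerSet (A n)) → g (⋃ n, A n) = ⨆ n, g (A n)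

theorem directed_subset_of_isLowerSet {ι : Type*} {A : ι → Set W} (hA : ∀ n, IsLowerSet (A n)) :
    Directed (· ⊆ ·) A := fun n m =>
  ((hA n).total (hA m)).elim (fun h => ⟨m, h, subset_rfl⟩) fun h => ⟨n, subset_rfl, h⟩

theorem directed_superset_of_isLowerSet {ι : Type*} {A : ι → Set W} (hA : ∀ n, IsLowerSet (A n)) :
    Directed (· ⊇ ·) A := fun n m =>
  ((hA n).total (hA m)).elim (fun h => ⟨n, subset_rfl, h⟩) fun h => ⟨m, h, subset_rfl⟩

open MeasureTheory in
theorem exists_isWeight [Countable W] [Nonempty W] :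
    ∃ g : Set W → unitInterval, IsWeight g := by
  let _ : MeasurableSpace W := ⊤
  obtain ⟨μ, _, hpos⟩ := exists_isProbabilityMeasure_singleton_pos W
  let e : Set.Iic (1 : ENNReal) ≃o unitInterval :=
    ENNReal.orderIsoIicOneBirational.symm.trans ENNReal.orderIsoUnitIntervalBirational
  let f : Set W → Set.Iic (1 : ENNReal) := fun A => ⟨μ A, prob_le_one⟩
  have map_empty : f ∅ = ⊥ := Subtype.ext (measure_empty (μ := μ))
  have map_univ : f Set.univ = ⊤ := Subtype.ext (measure_univ (μ := μ))
  have strictMono : StrictMono f := by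
    intro A B hAB
    obtain ⟨w, hwB, hwA⟩ := Set.exists_of_ssubset hAB
    change μ A < μ B
    calc μ A < μ A + μ {w} := ENNReal.lt_add_right (measure_ne_top _ _) (hpos w).ne'
      _ = μ (A ∪ {w}) := (measure_union (Set.disjoint_singleton_right.2 hwA)
          (measurableSet_singleton w)).symm
      _ ≤ μ B := measure_mono (Set.union_subset hAB.subset (Set.singleton_subset_iff.2 hwB))
  have map_iInter (A : ℕ → Set W) (hA : ∀ n, IsLowerSet (A n)) : f (⋂ n, A n) = ⨅ n, f (A n) := by
    ext
    rw [Set.Iic.coe_iInf]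
    change μ _ = 1 ⊓ ⨅ n, μ (A n)
    rw [(directed_superset_of_isLowerSet hA).measure_iInter
      (fun n => MeasurableSpace.measurableSet_top.nullMeasurableSet) ⟨0, measure_ne_top _ _⟩,
      inf_eq_right.2 (iInf_le_of_le (0 : ℕ) prob_le_one)]
  have map_iUnion (A : ℕ → Set W) (hA : ∀ n, IsLowerSet (A n)) : f (⋃ n, A n) = ⨆ n, f (A n) := by
    ext
    rw [Set.Iic.coe_iSup]
    exact (directed_subset_of_isLowerSet hA).measure_iUnion
  exact ⟨fun A => e (f A), {
    map_empty := (congrArg e map_empty).trans e.map_bot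
    map_univ := (congrArg e map_univ).trans e.map_top
    strictMono := e.strictMono.comp strictMono
    map_iInter := fun A hA => (congrArg e (map_iInter A hA)).trans (e.map_iInf _)
    map_iUnion := fun A hA => (congrArg e (map_iUnion A hA)).trans (e.map_iSup _) }⟩

namespace IsWeight

variable {g : Set W → unitInterval} (hg : IsWeight g)
include hg

theorem le_iff_subset {A B : Set W} (hA : IsLowerSet A) (hB : IsLowerSet B) :
    g A ≤ g B ↔ A ⊆ B := by
  refine ⟨fun hle => ?_, fun h => hg.strictMono.monotone h⟩
  by_contra hAB
  exact (hg.strictMono ⟨(hA.total hB).resolve_left hAB, hAB⟩).not_ge hle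

theorem map_inter {A B : Set W} (hA : IsLowerSet A) (hB : IsLowerSet B) :
    g (A ∩ B) = min (g A) (g B) := by
  rcases hA.total hB with h | h
  · rw [Set.inter_eq_left.2 h, min_eq_left (hg.strictMono.monotone h)]
  · rw [Set.inter_eq_right.2 h, min_eq_right (hg.strictMono.monotone h)]

theorem map_union {A B : Set W} (hA : IsLowerSet A) (hB : IsLowerSet B) :
    g (A ∪ B) = max (g A) (g B) := by
  rcases hA.total hB with h | h
  · rw [Set.union_eq_right.2 h, max_eq_right (hg.strictMono.monotone h)]
  · rw [Set.union_eq_left.2 h, max_eq_left (hg.strictMono.monotone h)]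

theorem map_biInter {ι : Type*} (s : Finset ι) {A : ι → Set W} (hA : ∀ i, IsLowerSet (A i)) :
    g (⋂ i ∈ s, A i) = s.inf fun i => g (A i) := by
  classical
  induction s using Finset.induction_on with
  | empty => exact (congrArg g (by simp)).trans hg.map_univ
  | insert i s _ ih =>
    rw [Finset.set_biInter_insert, Finset.inf_insert, ← ih]
    exact hg.map_inter (hA i) (isLowerSet_iInter₂ fun j _ => hA j)

theorem map_until {A B : ℕ → Set W} (hA : ∀ n, IsLowerSet (A n)) (hB : ∀ n, IsLowerSet (B n)) :
    g (⋃ n, (⋂ k ∈ Finset.range n, A k) ∩ B n) =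
      ⨆ n : ℕ, min ((Finset.range n).inf fun k => g (A k)) (g (B n)) := by
  have hinter (n : ℕ) : IsLowerSet (⋂ k ∈ Finset.range n, A k) :=
    isLowerSet_iInter₂ fun k _ => hA k
  rw [hg.map_iUnion _ fun n => (hinter n).inter (hB n)]
  simp only [hg.map_inter (hinter _) (hB _), hg.map_biInter _ hA]

end IsWeight

end Weight

namespace RelValuation

variable {W : Type*} [LinearOrder W] {T : Type*} {S : Equiv.Perm T} (V : RelValuation W S)

/-- The points of `W` at which a formula is true at time `t`. -/
def truthSet (φ : Formula) (t : T) : Set W := {w | (w, t) ∈ V.val φ}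

theorem isLowerSet_truthSet (φ : Formula) (t : T) : IsLowerSet (V.truthSet φ t) :=
  fun _ _ h hw => V.down h hw

theorem truthSet_and (φ ψ : Formula) (t : T) :
    V.truthSet (.and φ ψ) t = V.truthSet φ t ∩ V.truthSet ψ t := by
  rw [truthSet, V.and_eq]; rfl

theorem truthSet_or (φ ψ : Formula) (t : T) :
    V.truthSet (.or φ ψ) t = V.truthSet φ t ∪ V.truthSet ψ t := by
  rw [truthSet, V.or_eq]; rfl

theorem mem_truthSet_imp {φ ψ : Formula} {t : T} {w : W} :
    w ∈ V.truthSet (.imp φ ψ) t ↔ ∀ v ≤ w, v ∈ V.truthSet φ t → v ∈ V.truthSet ψ t := by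
  rw [truthSet, V.imp_eq]; rfl

theorem mem_truthSet_coimp {φ ψ : Formula} {t : T} {w : W} :
    w ∈ V.truthSet (.coimp φ ψ) t ↔ ∃ v ≥ w, v ∈ V.truthSet φ t ∧ v ∉ V.truthSet ψ t := by
  rw [truthSet, V.coimp_eq]; rfl

theorem truthSet_imp_of_subset {φ ψ : Formula} {t : T} (h : V.truthSet φ t ⊆ V.truthSet ψ t) :
    V.truthSet (.imp φ ψ) t = Set.univ :=
  Set.eq_univ_of_forall fun _ => V.mem_truthSet_imp.2 fun _ _ hv => h hv

theorem truthSet_imp_of_not_subset {φ ψ : Formula} {t : T}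
    (h : ¬V.truthSet φ t ⊆ V.truthSet ψ t) : V.truthSet (.imp φ ψ) t = V.truthSet ψ t := by
  obtain ⟨u, huφ, huψ⟩ := Set.not_subset.1 h
  ext w
  rw [V.mem_truthSet_imp]
  refine ⟨fun hw => ?_, fun hw v hv _ => V.isLowerSet_truthSet ψ t hv hw⟩
  obtain huw | hwu := le_total u w
  · exact absurd (hw u huw huφ) huψ
  · exact hw w le_rfl (V.isLowerSet_truthSet φ t hwu huφ)

theorem truthSet_coimp_of_subset {φ ψ : Formula} {t : T} (h : V.truthSet φ t ⊆ V.truthSet ψ t) :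
    V.truthSet (.coimp φ ψ) t = ∅ :=
  Set.eq_empty_of_forall_notMem fun _ hw =>
    let ⟨_, _, hφ, hψ⟩ := V.mem_truthSet_coimp.1 hw
    hψ (h hφ)

theorem truthSet_coimp_of_not_subset {φ ψ : Formula} {t : T}
    (h : ¬V.truthSet φ t ⊆ V.truthSet ψ t) : V.truthSet (.coimp φ ψ) t = V.truthSet φ t := by
  obtain ⟨u, huφ, huψ⟩ := Set.not_subset.1 h
  ext w
  rw [V.mem_truthSet_coimp]
  refine ⟨fun ⟨v, hv, hφ, _⟩ => V.isLowerSet_truthSet φ t hv hφ, fun hw => ?_⟩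
  obtain huw | hwu := le_total u w
  · exact ⟨w, le_rfl, hw, fun hψ => huψ (V.isLowerSet_truthSet ψ t huw hψ)⟩
  · exact ⟨u, hwu, huφ, huψ⟩

theorem truthSet_X (φ : Formula) (t : T) : V.truthSet (.X φ) t = V.truthSet φ (S t) :=
  Set.ext fun _ => V.mem_X

theorem truthSet_Y (φ : Formula) (t : T) : V.truthSet (.Y φ) t = V.truthSet φ (S⁻¹ t) :=
  Set.ext fun _ => V.mem_Y

theorem truthSet_G (φ : Formula) (t : T) :
    V.truthSet (.G φ) t = ⋂ n : ℕ, V.truthSet φ ((S ^ n) t) :=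
  Set.ext fun _ => V.mem_G.trans <| by simp [truthSet]

theorem truthSet_H (φ : Formula) (t : T) :
    V.truthSet (.H φ) t = ⋂ n : ℕ, V.truthSet φ ((S⁻¹ ^ n) t) :=
  Set.ext fun _ => V.mem_H.trans <| by simp [truthSet]

theorem truthSet_U (φ ψ : Formula) (t : T) : V.truthSet (.U φ ψ) t =
    ⋃ n : ℕ, (⋂ k ∈ Finset.range n, V.truthSet φ ((S ^ k) t)) ∩ V.truthSet ψ ((S ^ n) t) :=
  Set.ext fun _ => V.mem_U.trans <| by simp [truthSet]

theorem truthSet_S (φ ψ : Formula) (t : T) : V.truthSet (.S φ ψ) t =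
    ⋃ n : ℕ, (⋂ k ∈ Finset.range n, V.truthSet φ ((S⁻¹ ^ k) t)) ∩ V.truthSet ψ ((S⁻¹ ^ n) t) :=
  Set.ext fun _ => V.mem_S.trans <| by simp [truthSet]

/-- The real valuation measuring the truth sets of a bi-relational valuation by a weight. -/
noncomputable def realValuation {g : Set W → unitInterval} (hg : IsWeight g) :
    RealValuation S where
  V φ t := g (V.truthSet φ t)
  and_eq φ ψ t := by
    rw [V.truthSet_and, hg.map_inter (V.isLowerSet_truthSet φ t) (V.isLowerSet_truthSet ψ t)]
  or_eq φ ψ t := by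
    rw [V.truthSet_or, hg.map_union (V.isLowerSet_truthSet φ t) (V.isLowerSet_truthSet ψ t)]
  imp_eq φ ψ t := by
    split_ifs with hle <;>
      rw [hg.le_iff_subset (V.isLowerSet_truthSet φ t) (V.isLowerSet_truthSet ψ t)] at hle
    · rw [V.truthSet_imp_of_subset hle, hg.map_univ]
    · rw [V.truthSet_imp_of_not_subset hle]
  coimp_eq φ ψ t := by
    split_ifs with hle <;>
      rw [hg.le_iff_subset (V.isLowerSet_truthSet φ t) (V.isLowerSet_truthSet ψ t)] at hle
    · rw [V.truthSet_coimp_of_subset hle, hg.map_empty]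
    · rw [V.truthSet_coimp_of_not_subset hle]
  X_eq φ t := by rw [V.truthSet_X]
  Y_eq φ t := by rw [V.truthSet_Y]
  G_eq φ t := by rw [V.truthSet_G, hg.map_iInter _ fun n => V.isLowerSet_truthSet φ _]
  H_eq φ t := by rw [V.truthSet_H, hg.map_iInter _ fun n => V.isLowerSet_truthSet φ _]
  U_eq φ ψ t := by
    rw [V.truthSet_U, hg.map_until (fun n => V.isLowerSet_truthSet φ _)
      fun n => V.isLowerSet_truthSet ψ _]
  S_eq φ ψ t := by
    rw [V.truthSet_S, hg.map_until (fun n => V.isLowerSet_truthSet φ _)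
      fun n => V.isLowerSet_truthSet ψ _]

theorem realValuation_ne_one {g : Set W → unitInterval} (hg : IsWeight g) {φ : Formula} {t : T}
    {w : W} (h : (w, t) ∉ V.val φ) : (V.realValuation hg).V φ t ≠ 1 :=
  ((hg.strictMono (Set.ssubset_univ_iff.2 fun huniv =>
    h (Set.eq_univ_iff_forall.1 huniv w))).trans_eq hg.map_univ).ne

end RelValuation

/-! ### Falsifiability -/

section Falsifiability

variable {φ : Formula} {Sg : Set Formula}

theorem RealFalsifiable.nonempty_smallWitness (h : RealFalsifiable.{u} φ) (hfin : Sg.Finite)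
    (hsub : SubformulaClosed Sg) : Nonempty (SmallWitness Sg φ) := by
  simp only [RealFalsifiable, RealValid, not_forall] at h
  obtain ⟨T, S, V, t, ht⟩ := h
  exact (V.typeFlow_realising hsub hfin t).nonempty_smallWitness hfin
    (w₀ := ⟨1, Set.mem_Ioi.2 zero_lt_one⟩) fun hmem => ht (le_antisymm unitInterval.le_one' hmem.2)

theorem RelFalsifiable.nonempty_smallWitness (h : RelFalsifiable.{v, w} φ) (hfin : Sg.Finite)
    (hsub : SubformulaClosed Sg) : Nonempty (SmallWitness Sg φ) := by
  simp only [RelFalsifiable, RelValid, not_forall] at h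
  obtain ⟨W, _, T, S, V, hne⟩ := h
  obtain ⟨⟨w, t⟩, hwt⟩ := (Set.ne_univ_iff_exists_notMem _).1 hne
  exact (V.typeFlow_exact hsub t).realising.nonempty_smallWitness hfin
    (w₀ := w) fun hmem => hwt hmem.2

theorem SmallWitness.relFalsifiable (x : SmallWitness Sg φ) (hSg : Sg.Countable)
    (hsub : SubformulaClosed Sg) (hφ : φ ∈ Sg) : RelFalsifiable.{v, w} φ := by
  obtain ⟨W, _, _, F, hF, w₀, hw₀⟩ := x.exists_typeFlow hSg
  intro hvalid
  have hF' := hF.comap (ULift.orderIso.{v} (α := W))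
  have hmem : ((⟨w₀⟩, ⟨0⟩) : ULift.{v} W × ULift.{w} ℤ) ∈
      (F.comap ULift.orderIso).relValuation.val φ := by
    rw [hvalid]
    trivial
  exact hw₀ ((hF'.mem_relValuation_iff hsub hφ _ _).1 hmem)

theorem SmallWitness.realFalsifiable (x : SmallWitness Sg φ) (hSg : Sg.Countable)
    (hsub : SubformulaClosed Sg) (hφ : φ ∈ Sg) : RealFalsifiable.{u} φ := by
  obtain ⟨W, _, _, F, hF, w₀, hw₀⟩ := x.exists_typeFlow hSg
  have : Nonempty W := ⟨w₀⟩
  obtain ⟨g, hg⟩ := exists_isWeight (W := W)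
  have hnot : (w₀, ⟨0⟩) ∉ F.relValuation.{u}.val φ :=
    fun hmem => hw₀ ((hF.mem_relValuation_iff hsub hφ w₀ _).1 hmem)
  exact fun hvalid => F.relValuation.realValuation_ne_one hg hnot (hvalid _ _ _ _)

end Falsifiability

end GTL

theorem mainTheorem7 (φ : GTL.Formula) (Sg : Set GTL.Formula) (hfin : Sg.Finite)
    (hsub : GTL.SubformulaClosed Sg) (hφ : φ ∈ Sg) :
    (GTL.RealFalsifiable.{u} φ ↔ Nonempty (GTL.SmallWitness Sg φ)) ∧
    (GTL.RelFalsifiable.{v, w} φ ↔ Nonempty (GTL.SmallWitness Sg φ)) :=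
  ⟨⟨fun h => h.nonempty_smallWitness hfin hsub,
      fun ⟨x⟩ => x.realFalsifiable hfin.countable hsub hφ⟩,
    fun h => h.nonempty_smallWitness hfin hsub,
    fun ⟨x⟩ => x.relFalsifiable hfin.countable hsub hφ⟩
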